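/- Let $n\ge 1$, $0\le k\le n$, $r\ge 0$, and let $\mathcal T_h$ be a (nonempty, finite, conforming) simplicial mesh of a polyhedral domain $\Omega\subset\mathbb R^n$. Let $\mathcal P_r\Lambda^j(K)$ be the $j$-forms on $K\in\mathcal T_h$ with polynomial coefficients of degree $\le r$, and $\mathcal P_{r}^-\Lambda^j(K)=\mathcal P_{r-1}\Lambda^j(K)+\kappa\mathcal P_{r-1}\Lambda^{j+1}(K)$ for $r\ge1$, where $\kappa$ is contraction with the vector field $x\mapsto x$. Choose one of the stable pairs $$W_h^{k-1}(K)=\mathcal P_{r+1}\Lambda^{k-1}(K)\ \text{ or }\ \mathcal P_{r+1}^-\Lambda^{k-1}(K),\qquad W_h^{k}(K)=\mathcal P_{r}\Lambda^{k}(K)\ (\text{allowed only if } r\ge 1)\ \text{ or }\ \mathcal P_{r+1}^-\Lambda^{k}(K),$$ with all spaces of $(-1)$-forms zero. For $j\in\{k-1,k\}$ let $W_h^j=\prod_K W_h^j(K)$, $V_h^j=H\Lambda^j(\Omega)\cap W_h^j$ (so that $V_h^j=\mathcal P_\cdot^\pm\Lambda^j(\mathcal T_h)$), and let $\widehat V_h^{j,\mathrm{tan}}$,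 $\widehat W_h^{j,\mathrm{tan}}$ be the spaces of tangential traces on $\partial\mathcal T_h=\bigsqcup_K\partial K$ of the elements of $V_h^j$, $W_h^j$, and $\widehat W_h^{j,\mathrm{nor}}=(\widehat W_h^{j,\mathrm{tan}})^*$. Let $\mathring W_h^j(K)$ be the forms in $W_h^j(K)$ with zero tangential trace on $\partial K$. Let $\mathfrak H_h^k$ be the closed forms in $V_h^k$ that are $L^2$-orthogonal to $\mathrm dV_h^{k-1}$, let $\mathring{\mathfrak H}_h^k(K)$ be the closed forms in $\mathring W_h^k(K)$ that are $L^2(K)$-orthogonal to $\mathrm d\mathring W_h^{k-1}(K)$, and let $\overline{\mathfrak H}_h^k=\prod_K\mathring{\mathfrak H}_h^k(K)$. Let $f\in L^2\Lambda^k(\Omega)$. The standard FEEC system for the Hodge--Laplace problem is: find $(\sigma_h,u_h,p_h)\in V_h^{k-1}\times V_h^k\times\mathfrak H_h^k$ such that $$(\sigma_h,\tau_h)_\Omega-(u_h,\mathrm d\tau_h)_\Omega=0,\quad (\mathrm d\sigma_h,v_h)_\Omega+(\mathrm du_h,\mathrm dv_h)_\Omega+(p_h,v_h)_\Omega=(f,v_h)_\Omega,\quad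 (u_h,q_h)_\Omega=0$$ for all $\tau_h\in V_h^{k-1}$, $v_h\in V_h^k$, $q_h\in\mathfrak H_h^k$. Its hybridization is the saddle point problem of finding local variables $x_h=(\sigma_h,u_h,\overline p_h,\widehat u_h^{\mathrm{nor}},\widehat\rho_h^{\mathrm{nor}})\in X_h=W_h^{k-1}\times W_h^k\times\overline{\mathfrak H}_h^k\times\widehat W_h^{k-1,\mathrm{nor}}\times\widehat W_h^{k,\mathrm{nor}}$ and global variables $y_h=(p_h,\overline u_h,\widehat\sigma_h^{\mathrm{tan}},\widehat u_h^{\mathrm{tan}})\in Y_h=\mathfrak H_h^k\times\overline{\mathfrak H}_h^k\times\widehat V_h^{k-1,\mathrm{tan}}\times\widehat V_h^{k,\mathrm{tan}}$ with $a(x_h,x_h')+b(x_h',y_h)=(f,v_h)_{\mathcal T_h}$ for all $x_h'=(\tau_h,v_h,\overline q_h,\widehat v_h^{\mathrm{nor}},\widehat\eta_h^{\mathrm{nor}})\in X_h$ and $b(x_h,y_h')=0$ for all $y_h'\in Y_h$, where $$a(x_h,x_h')=-(\sigma_h,\tau_h)+(u_h,\mathrm d\tau_h)-\langle\widehat u_h^{\mathrm{nor}},\tau_h^{\mathrm{tan}}\rangle+(\mathrm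 d\sigma_h,v_h)+(\mathrm du_h,\mathrm dv_h)+(\overline p_h,v_h)-\langle\widehat\rho_h^{\mathrm{nor}},v_h^{\mathrm{tan}}\rangle+(u_h,\overline q_h)-\langle\sigma_h^{\mathrm{tan}},\widehat v_h^{\mathrm{nor}}\rangle-\langle u_h^{\mathrm{tan}},\widehat\eta_h^{\mathrm{nor}}\rangle,$$ $$b\bigl(x_h,(q_h,\overline v_h,\widehat\tau_h^{\mathrm{tan}},\widehat v_h^{\mathrm{tan}})\bigr)=(u_h,q_h)-(\overline p_h,\overline v_h)+\langle\widehat u_h^{\mathrm{nor}},\widehat\tau_h^{\mathrm{tan}}\rangle+\langle\widehat\rho_h^{\mathrm{nor}},\widehat v_h^{\mathrm{tan}}\rangle ,$$ with all inner products and pairings taken element by element. The hybridized and condensed FEEC system is the system for $y_h\in Y_h$ alone obtained by eliminating $x_h$ with the local solvers: $b(\mathsf X_{y_h},y_h')=-b(\mathsf X_f,y_h')$ for all $y_h'\in Y_h$, where $a(\mathsf X_f,x_h')=(f,v_h)_{\mathcal T_h}$ and $a(\mathsf X_{y_h},x_h')=-b(x_h',y_h)$ for all $x_h'\in X_h$.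 The size of a system is the dimension of its space of unknowns. Then the hybridized and condensed FEEC system is strictly smaller than the standard FEEC system, i.e. $$\dim\mathfrak H_h^k+\dim\overline{\mathfrak H}_h^k+\dim\widehat V_h^{k-1,\mathrm{tan}}+\dim\widehat V_h^{k,\mathrm{tan}}<\dim V_h^{k-1}+\dim V_h^k+\dim\mathfrak H_h^k ,$$ if and only if $r\ge 1$ and either * the choice $V_h^k=\mathcal P_r\Lambda^k(\mathcal T_h)$ was made and $r\ge n-k+1$, or * the choice $V_h^k=\mathcal P_{r+1}^-\Lambda^k(\mathcal T_h)$ was made and $r\ge n-k$. -/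

import Mathlib

noncomputable section

open MeasureTheory
open scoped ContDiff

namespace FEEC

/-! ### Alternating forms and differential forms on `ℝⁿ` -/

/-- Euclidean space `ℝⁿ`. -/
abbrev Euc (n : ℕ) : Type := EuclideanSpace ℝ (Fin n)

/-- `Alt^k ℝⁿ`. -/
abbrev Alt (n k : ℕ) : Type := Euc n [⋀^Fin k]→L[ℝ] ℝ

/-- The standard basis vector `e_i` of `ℝⁿ`. -/
def stdVec (n : ℕ) (i : Fin n) : Euc n := EuclideanSpace.single i 1

/-- The inner product of alternating forms,
`(α, β) = ∑_{i₁ < ⋯ < i_k} α(e_{i₁}, …, e_{i_k}) β(e_{i₁}, …, e_{i_k})`. -/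
def altInner {n k : ℕ} (α β : Alt n k) : ℝ :=
  ∑ I : Fin k ↪o Fin n, α (fun j => stdVec n (I j)) * β (fun j => stdVec n (I j))

/-- The space `C^∞ Λ^k(ℝⁿ)` of smooth differential `k`-forms, as a subspace of all forms. -/
def smoothForms (n k : ℕ) : Submodule ℝ (Euc n → Alt n k) where
  carrier := {φ | ContDiff ℝ ∞ φ}
  zero_mem' := show ContDiff ℝ ∞ (fun _ : Euc n => (0 : Alt n k)) from contDiff_const
  add_mem' := fun {φ ψ} (h : ContDiff ℝ ∞ φ) (h' : ContDiff ℝ ∞ ψ) =>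
    show ContDiff ℝ ∞ (φ + ψ) from ContDiff.add h h'
  smul_mem' := fun c φ (h : ContDiff ℝ ∞ φ) =>
    show ContDiff ℝ ∞ (c • φ) from ContDiff.const_smul c h

/-- The type of smooth differential `k`-forms on `ℝⁿ`. -/
def SForm (n k : ℕ) : Type := smoothForms n k

namespace SForm

variable {n k : ℕ}

instance : AddCommGroup (SForm n k) := Submodule.addCommGroup (smoothForms n k)

instance : Module ℝ (SForm n k) := Submodule.module (smoothForms n k)

/-- The underlying function `x ↦ φ_x` of a smooth form. -/
def val (φ : SForm n k) : Euc n → Alt n k := Subtype.val (p := (· ∈ smoothForms n k)) φ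

/-- A smooth form from a smooth function. -/
def mk (φ : Euc n → Alt n k) (h : ContDiff ℝ ∞ φ) : SForm n k :=
  Subtype.mk (p := (· ∈ smoothForms n k)) φ h

@[simp] theorem val_mk (φ : Euc n → Alt n k) (h : ContDiff ℝ ∞ φ) : (mk φ h).val = φ := rfl

@[simp] theorem val_zero : (0 : SForm n k).val = 0 := rfl

@[simp] theorem val_add (φ ψ : SForm n k) : (φ + ψ).val = φ.val + ψ.val := rfl

@[simp] theorem val_smul (c : ℝ) (φ : SForm n k) : (c • φ).val = c • φ.val := rfl

@[ext] theorem ext {φ ψ : SForm n k} (h : ∀ x, φ.val x = ψ.val x) : φ = ψ :=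
  Subtype.ext (funext h)

theorem contDiff (φ : SForm n k) : ContDiff ℝ ∞ φ.val :=
  Subtype.property (p := (· ∈ smoothForms n k)) φ

end SForm

theorem contDiff_extDeriv {n k : ℕ} (φ : SForm n k) : ContDiff ℝ ∞ (extDeriv φ.val) := by
  have h : ContDiff ℝ ∞ (fderiv ℝ φ.val) := φ.contDiff.fderiv_right (m := ∞) (by simp)
  exact ContDiff.comp (g := ContinuousAlternatingMap.alternatizeUncurryFinCLM ℝ (Euc n) ℝ)
    (ContinuousLinearMap.contDiff _) h

/-- The exterior derivative `d` of smooth forms. -/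
def extD (n k : ℕ) : SForm n k →ₗ[ℝ] SForm n (k + 1) where
  toFun φ := .mk (extDeriv φ.val) (contDiff_extDeriv φ)
  map_add' φ ψ := SForm.ext fun x =>
    extDeriv_add (φ.contDiff.differentiable (by simp) x) (ψ.contDiff.differentiable (by simp) x)
  map_smul' c φ := SForm.ext fun x => extDeriv_smul c φ.1

/-- The exterior derivative from `(k-1)`-forms to `k`-forms. For `k = 0` it is zero: there are no
`(-1)`-forms, and every space of `(-1)`-forms below is taken to be the zero space. -/
def extDPrev (n : ℕ) : (k : ℕ) → SForm n (k - 1) →ₗ[ℝ] SForm n k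
  | 0 => 0
  | k + 1 => extD n k

theorem contDiff_contraction {n k : ℕ} (φ : SForm n (k + 1)) :
    ContDiff ℝ ∞ (fun x => (φ.val x).curryLeft x) := by
  have h : ContDiff ℝ ∞ (fun x => (φ.val x).curryLeft) :=
    ContDiff.comp (g := ContinuousAlternatingMap.curryLeftLI (𝕜 := ℝ) (E := Euc n) (F := ℝ)
      (n := k)) (LinearIsometry.contDiff _) φ.contDiff
  exact h.clm_apply contDiff_id

/-- The Koszul differential `κ`: contraction with the vector field `x ↦ x`. -/
def koszul (n k : ℕ) : SForm n (k + 1) →ₗ[ℝ] SForm n k where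
  toFun φ := .mk (fun x => (φ.val x).curryLeft x) (contDiff_contraction φ)
  map_add' _ _ := rfl
  map_smul' _ _ := rfl

/-- The codifferential on Euclidean space,
`(δη)_x = - ∑ᵢ ι_{eᵢ} (∂ᵢ η)_x`. -/
def codiff {n k : ℕ} (η : Euc n → Alt n (k + 1)) (x : Euc n) : Alt n k :=
  -∑ i : Fin n, (fderiv ℝ η x (stdVec n i)).curryLeft (stdVec n i)

/-! ### Polynomial differential forms -/

/-- `P_r Λ^k`: sums of forms `q α`, with `q` a polynomial of degree at most `r` and `α` a constant
`k`-form. -/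
def polyForms (n r k : ℕ) : Submodule ℝ (SForm n k) :=
  Submodule.span ℝ {φ | ∃ (q : MvPolynomial (Fin n) ℝ) (α : Alt n k), q.totalDegree ≤ r ∧
    ∀ x : Euc n, φ.val x = MvPolynomial.eval (fun i => x i) q • α}

/-- `P_r^- Λ^k = P_{r-1} Λ^k + κ P_{r-1} Λ^{k+1}` for `r ≥ 1`, and `P_0^- Λ^k = 0`. -/
def trimmedForms (n : ℕ) : (r k : ℕ) → Submodule ℝ (SForm n k)
  | 0, _ => ⊥
  | r + 1, k => polyForms n r k ⊔ (polyForms n r (k + 1)).map (koszul n k)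

/-- The two families of elements: `P_r Λ` (`full`) and `P_r^- Λ` (`trimmed`). -/
inductive Family where
  | full
  | trimmed

/-- `P_r^± Λ^k`. -/
def elementForms (n : ℕ) : Family → (r k : ℕ) → Submodule ℝ (SForm n k)
  | .full, r, k => polyForms n r k
  | .trimmed, r, k => trimmedForms n r k

/-- The local space of `(k-1)`-forms in a stable pair: `P_{r+1}^± Λ^{k-1}`, which is zero if
`k = 0`. -/
def sigmaElement (n r k : ℕ) (s : Family) : Submodule ℝ (SForm n (k - 1)) :=
  match k with
  | 0 => ⊥
  | j + 1 => elementForms n s (r + 1) j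

/-- The local space of `k`-forms in a stable pair: `P_r Λ^k` or `P_{r+1}^- Λ^k`. -/
def uElement (n r k : ℕ) : Family → Submodule ℝ (SForm n k)
  | .full => elementForms n .full r k
  | .trimmed => elementForms n .trimmed (r + 1) k

/-! ### The Sobolev space `H Λ^k(Ω)` -/

/-- `w` is the weak exterior derivative of `v` in `Ω`: `(w, η)_Ω = (v, δη)_Ω` for every smooth
`(k+1)`-form `η` with compact support in `Ω`. -/
def IsWeakExtDeriv {n k : ℕ} (Ω : Set (Euc n)) (v : Euc n → Alt n k)
    (w : Euc n → Alt n (k + 1)) : Prop :=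
  ∀ η : SForm n (k + 1), HasCompactSupport η.val → tsupport η.val ⊆ Ω →
    ∫ x in Ω, altInner (w x) (η.val x) = ∫ x in Ω, altInner (v x) (codiff η.val x)

theorem altInner_add_left {n k : ℕ} (α α' β : Alt n k) :
    altInner (α + α') β = altInner α β + altInner α' β := by
  simp [altInner, add_mul, Finset.sum_add_distrib]

theorem altInner_smul_left {n k : ℕ} (c : ℝ) (α β : Alt n k) :
    altInner (c • α) β = c * altInner α β := by
  simp [altInner, Finset.mul_sum, mul_assoc]

theorem altInner_comm {n k : ℕ} (α β : Alt n k) : altInner α β = altInner β α := by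
  simp [altInner, mul_comm]

/-- `v ∈ L² Λ^k(Ω)`: the coefficients `v(e_{i₁}, …, e_{i_k})`, `i₁ < ⋯ < i_k`, of `v` are square
integrable on `Ω`. -/
def MemL2 {n k : ℕ} (Ω : Set (Euc n)) (v : Euc n → Alt n k) : Prop :=
  ∀ I : Fin k ↪o Fin n, MemLp (fun x => v x (fun j => stdVec n (I j))) 2 (volume.restrict Ω)

theorem integrable_altInner {n k : ℕ} {Ω : Set (Euc n)} {v w : Euc n → Alt n k}
    (hv : MemL2 Ω v) (hw : MemL2 Ω w) :
    Integrable (fun x => altInner (v x) (w x)) (volume.restrict Ω) :=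
  integrable_finsetSum _ fun I _ => (hv I).integrable_mul (hw I)

theorem continuous_codiff {n k : ℕ} (η : SForm n (k + 1)) : Continuous (codiff η.val) := by
  unfold codiff
  refine (continuous_finsetSum _ fun i _ => ?_).neg
  have h : Continuous (fun x => fderiv ℝ η.val x (stdVec n i)) :=
    (η.contDiff.continuous_fderiv (by simp)).clm_apply continuous_const
  exact ((ContinuousAlternatingMap.curryLeftLI (𝕜 := ℝ) (E := Euc n) (F := ℝ)
    (n := k)).continuous.comp h).clm_apply continuous_const

theorem hasCompactSupport_codiff {n k : ℕ} {η : SForm n (k + 1)}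
    (hη : HasCompactSupport η.val) : HasCompactSupport (codiff η.val) := by
  refine (hη.fderiv (𝕜 := ℝ)).mono fun x hx => ?_
  contrapose! hx
  simp only [Function.mem_support, not_not] at hx ⊢
  have h0 : (0 : Alt n (k + 1)).curryLeft = 0 := by ext; simp
  simp [codiff, hx, h0]

theorem memL2_test {n k : ℕ} {Ω : Set (Euc n)} {η : Euc n → Alt n k} (h : Continuous η)
    (h' : HasCompactSupport η) : MemL2 Ω η := by
  intro I
  have hc : Continuous (fun x => η x (fun j => stdVec n (I j))) :=
    (ContinuousAlternatingMap.apply ℝ (Euc n) ℝ (fun j => stdVec n (I j))).continuous.comp h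
  have hs : HasCompactSupport (fun x => η x (fun j => stdVec n (I j))) := by
    refine h'.mono fun x hx => ?_
    contrapose! hx
    simp only [Function.mem_support, not_not] at hx ⊢
    simp [hx]
  exact (hc.memLp_of_hasCompactSupport hs).restrict Ω

theorem MemL2.zero {n k : ℕ} (Ω : Set (Euc n)) : MemL2 Ω (0 : Euc n → Alt n k) :=
  fun _ => MemLp.zero

theorem MemL2.add {n k : ℕ} {Ω : Set (Euc n)} {v v' : Euc n → Alt n k} (h : MemL2 Ω v)
    (h' : MemL2 Ω v') : MemL2 Ω (v + v') :=
  fun I => (h I).add (h' I)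

theorem MemL2.smul {n k : ℕ} {Ω : Set (Euc n)} {v : Euc n → Alt n k} (c : ℝ)
    (h : MemL2 Ω v) : MemL2 Ω (c • v) :=
  fun I => (h I).const_smul c

theorem IsWeakExtDeriv.add {n k : ℕ} {Ω : Set (Euc n)} {v v' : Euc n → Alt n k}
    {w w' : Euc n → Alt n (k + 1)} (h : IsWeakExtDeriv Ω v w) (h' : IsWeakExtDeriv Ω v' w')
    (hv : MemL2 Ω v) (hv' : MemL2 Ω v')
    (hw : MemL2 Ω w) (hw' : MemL2 Ω w') :
    IsWeakExtDeriv Ω (v + v') (w + w') := by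
  intro η hc hs
  have t1 : MemL2 Ω η.val := memL2_test η.contDiff.continuous hc
  have t2 : MemL2 Ω (codiff η.val) :=
    memL2_test (continuous_codiff η) (hasCompactSupport_codiff hc)
  simp only [Pi.add_apply, altInner_add_left]
  rw [integral_add (integrable_altInner hw t1) (integrable_altInner hw' t1),
    integral_add (integrable_altInner hv t2) (integrable_altInner hv' t2), h η hc hs, h' η hc hs]

theorem IsWeakExtDeriv.smul {n k : ℕ} {Ω : Set (Euc n)} {v : Euc n → Alt n k}
    {w : Euc n → Alt n (k + 1)} (c : ℝ) (h : IsWeakExtDeriv Ω v w) :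
    IsWeakExtDeriv Ω (c • v) (c • w) := by
  intro η hc hs
  simp only [Pi.smul_apply, altInner_smul_left]
  rw [integral_const_mul, integral_const_mul, h η hc hs]

theorem IsWeakExtDeriv.zero {n k : ℕ} (Ω : Set (Euc n)) :
    IsWeakExtDeriv Ω (0 : Euc n → Alt n k) 0 := by
  intro η _ _
  simp [altInner]

/-- Membership in `H Λ^k(Ω)`: square-integrable `k`-forms with a square-integrable weak exterior
derivative. -/
def MemHLambda {n k : ℕ} (Ω : Set (Euc n)) (v : Euc n → Alt n k) : Prop :=
  MemL2 Ω v ∧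
    ∃ w : Euc n → Alt n (k + 1), MemL2 Ω w ∧ IsWeakExtDeriv Ω v w

theorem MemHLambda.zero {n k : ℕ} (Ω : Set (Euc n)) :
    MemHLambda Ω (0 : Euc n → Alt n k) := by
  exact ⟨MemL2.zero Ω, 0, MemL2.zero Ω, IsWeakExtDeriv.zero Ω⟩

theorem MemHLambda.add {n k : ℕ} {Ω : Set (Euc n)} {v v' : Euc n → Alt n k}
    (h : MemHLambda Ω v) (h' : MemHLambda Ω v') : MemHLambda Ω (v + v') := by
  obtain ⟨hv, w, hw, e⟩ := h
  obtain ⟨hv', w', hw', e'⟩ := h'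
  exact ⟨hv.add hv', w + w', hw.add hw', e.add e' hv hv' hw hw'⟩

theorem MemHLambda.smul {n k : ℕ} {Ω : Set (Euc n)} {v : Euc n → Alt n k} (c : ℝ)
    (h : MemHLambda Ω v) : MemHLambda Ω (c • v) := by
  obtain ⟨hv, w, hw, e⟩ := h
  exact ⟨hv.smul c, c • w, hw.smul c, e.smul c⟩

/-- The space `H Λ^k(Ω)` (of representatives of almost everywhere classes). -/
def HLambda {n : ℕ} (Ω : Set (Euc n)) (k : ℕ) : Submodule ℝ (Euc n → Alt n k) where
  carrier := {v | MemHLambda Ω v}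
  zero_mem' := MemHLambda.zero Ω
  add_mem' := MemHLambda.add
  smul_mem' := fun c _ h => MemHLambda.smul c h

/-! ### Forms and traces on a single simplex -/

theorem continuous_coeff {n k : ℕ} (u : SForm n k) (e : Fin k → Euc n) :
    Continuous (fun x => u.val x e) :=
  (ContinuousAlternatingMap.apply ℝ (Euc n) ℝ e).continuous.comp u.contDiff.continuous

theorem integrableOn_altInner {n k : ℕ} (s : Finset (Euc n)) (v w : SForm n k) :
    IntegrableOn (fun x => altInner (v.val x) (w.val x)) (convexHull ℝ (s : Set (Euc n))) := by
  refine ContinuousOn.integrableOn_compact (s.finite_toSet.isCompact_convexHull ℝ) ?_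
  refine Continuous.continuousOn (continuous_finsetSum _ fun I _ => ?_)
  exact (continuous_coeff v _).mul (continuous_coeff w _)

/-- The `L²` inner product `(v, w)_K` on the simplex `K` with vertex set `s`, as a function. -/
def cellIntegral {n k : ℕ} (s : Finset (Euc n)) (v w : SForm n k) : ℝ :=
  ∫ x in convexHull ℝ (s : Set (Euc n)), altInner (v.val x) (w.val x)

theorem cellIntegral_comm {n k : ℕ} (s : Finset (Euc n)) (v w : SForm n k) :
    cellIntegral s v w = cellIntegral s w v := by
  unfold cellIntegral
  simp_rw [altInner_comm]

theorem cellIntegral_add {n k : ℕ} (s : Finset (Euc n)) (v v' w : SForm n k) :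
    cellIntegral s (v + v') w = cellIntegral s v w + cellIntegral s v' w := by
  unfold cellIntegral
  rw [← integral_add (integrableOn_altInner s v w) (integrableOn_altInner s v' w)]
  simp only [SForm.val_add, Pi.add_apply, altInner_add_left]

theorem cellIntegral_smul {n k : ℕ} (s : Finset (Euc n)) (c : ℝ) (v w : SForm n k) :
    cellIntegral s (c • v) w = c * cellIntegral s v w := by
  unfold cellIntegral
  rw [← integral_const_mul]
  simp only [SForm.val_smul, Pi.smul_apply, altInner_smul_left]

/-- The `L²` inner product `(v, w)_K`, as a bilinear form. -/
def cellInner {n k : ℕ} (s : Finset (Euc n)) : SForm n k →ₗ[ℝ] SForm n k →ₗ[ℝ] ℝ :=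
  LinearMap.mk₂ ℝ (cellIntegral s) (cellIntegral_add s) (cellIntegral_smul s)
    (fun v w w' => by
      rw [cellIntegral_comm, cellIntegral_add, cellIntegral_comm s w, cellIntegral_comm s w'])
    (fun c v w => by
      rw [cellIntegral_comm, cellIntegral_smul, cellIntegral_comm s w, smul_eq_mul])

/-- Forms on the boundary `∂K` of the simplex `K` with vertex set `s`. The boundary is the union of
the facets `F_a` opposite to the vertices `a` of `K`; to each `a` and each point of `F_a` is
assigned an alternating form on the tangent space of `F_a`. -/
abbrev BoundaryForm {n : ℕ} (s : Finset (Euc n)) (k : ℕ) : Type :=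
  (a : s) → (convexHull ℝ ((s : Set (Euc n)) \ {a.1})) →
    ((vectorSpan ℝ ((s : Set (Euc n)) \ {a.1})) [⋀^Fin k]→L[ℝ] ℝ)

/-- The tangential trace `v ↦ v^tan` on `∂K`: pullback by the inclusions of the facets of `K`. -/
def cellTrace {n k : ℕ} (s : Finset (Euc n)) : SForm n k →ₗ[ℝ] BoundaryForm s k where
  toFun v a x := (v.val x.1).compContinuousLinearMap
    (vectorSpan ℝ ((s : Set (Euc n)) \ {a.1})).subtypeL
  map_add' _ _ := rfl
  map_smul' _ _ := rfl

/-- For a local space `W_h(K) = P`, the subspace `W̊_h(K)` of forms with zero tangential trace. -/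
def cellZeroTrace {n k : ℕ} (s : Finset (Euc n)) (P : Submodule ℝ (SForm n k)) :
    Submodule ℝ (SForm n k) :=
  P ⊓ LinearMap.ker (cellTrace s)

/-- The local harmonic `k`-forms in `W̊_h^k(K)`, for `W_h^{k-1}(K) = A` and `W_h^k(K) = B`: closed
forms in `W̊_h^k(K)` which are `L²(K)`-orthogonal to `d W̊_h^{k-1}(K)`. -/
def cellHarmonic {n k : ℕ} (s : Finset (Euc n)) (A : Submodule ℝ (SForm n (k - 1)))
    (B : Submodule ℝ (SForm n k)) : Submodule ℝ (SForm n k) :=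
  cellZeroTrace s B ⊓ LinearMap.ker (extD n k) ⊓
    ⨅ τ ∈ cellZeroTrace s A, LinearMap.ker (cellInner s (extDPrev n k τ))

/-! ### Simplicial meshes and finite element spaces -/

/-- A conforming simplicial mesh in `ℝⁿ`: a nonempty finite geometric simplicial complex in which
every face is a face of an `n`-simplex. -/
structure SimplicialMesh (n : ℕ) extends Geometry.SimplicialComplex ℝ (Euc n) where
  finite_faces : faces.Finite
  nonempty_faces : faces.Nonempty
  pure : ∀ s ∈ faces, ∃ t ∈ faces, s ⊆ t ∧ t.card = n + 1

namespace SimplicialMesh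

variable {n : ℕ} (M : SimplicialMesh n)

/-- The elements `K ∈ 𝒯_h`: the `n`-simplices of the mesh, given by their vertex sets. -/
def cells : Set (Finset (Euc n)) := {s | s ∈ M.faces ∧ s.card = n + 1}

instance : Fintype M.cells := (M.finite_faces.subset fun _ h => h.1).fintype

/-- The open polyhedral domain `Ω` triangulated by the mesh. -/
def domain : Set (Euc n) := interior (⋃ s ∈ M.cells, convexHull ℝ (s : Set (Euc n)))

/-- Families of smooth `k`-forms, one for each element of the mesh. -/
abbrev Broken (k : ℕ) : Type := M.cells → SForm n k

/-- The form on `Ω` with restriction `v K` to each `K ∈ 𝒯_h` (it is relevant only up to the null set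
where elements meet). -/
def glue (k : ℕ) : M.Broken k →ₗ[ℝ] (Euc n → Alt n k) where
  toFun v x := ∑ K : M.cells,
    (convexHull ℝ (K.1 : Set (Euc n))).indicator (fun y => (v K).val y) x
  map_add' v w := by
    ext1 x
    simp only [Pi.add_apply, ← Finset.sum_add_distrib]
    refine Finset.sum_congr rfl fun K _ => ?_
    by_cases h : x ∈ convexHull ℝ (K.1 : Set (Euc n)) <;> simp [h]
  map_smul' c v := by
    ext1 x
    simp only [Pi.smul_apply, Finset.smul_sum, RingHom.id_apply]
    refine Finset.sum_congr rfl fun K _ => ?_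
    by_cases h : x ∈ convexHull ℝ (K.1 : Set (Euc n)) <;> simp [h]

/-- The broken inner product `(v, w)_{𝒯_h} = ∑_K (v, w)_K`. -/
def inner {k : ℕ} (v w : M.Broken k) : ℝ := ∑ K : M.cells, cellInner K.1 (v K) (w K)

/-- The load functional `w ↦ (f, w)_{𝒯_h}` of a form `f ∈ L² Λ^k(Ω)`. -/
def load {k : ℕ} (f : Euc n → Alt n k) (w : M.Broken k) : ℝ :=
  ∑ K : M.cells, ∫ x in convexHull ℝ (K.1 : Set (Euc n)), altInner (f x) ((w K).val x)

/-- The elementwise exterior derivative of broken `k`-forms. -/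
def d (k : ℕ) : M.Broken k →ₗ[ℝ] M.Broken (k + 1) := (extD n k).compLeft M.cells

/-- The elementwise exterior derivative from broken `(k-1)`-forms to broken `k`-forms. -/
def dPrev (k : ℕ) : M.Broken (k - 1) →ₗ[ℝ] M.Broken k := (extDPrev n k).compLeft M.cells

/-- The tangential trace of broken forms, on `∂𝒯_h = ⨆ ∂K` (disjoint union). -/
def trace (k : ℕ) : M.Broken k →ₗ[ℝ] ((K : M.cells) → BoundaryForm K.1 k) :=
  LinearMap.pi fun K => cellTrace K.1 ∘ₗ LinearMap.proj K

/-- `W_h = ∏_K W_h(K)`, where `W_h(K) = P` for all `K`. -/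
def brokenSpace {k : ℕ} (P : Submodule ℝ (SForm n k)) : Submodule ℝ (M.Broken k) :=
  Submodule.pi Set.univ fun _ => P

/-- `V_h = H Λ(Ω) ∩ W_h`. For `P = P_r^± Λ^k` this is `P_r^± Λ^k(𝒯_h)`. -/
def femSpace {k : ℕ} (P : Submodule ℝ (SForm n k)) : Submodule ℝ (M.Broken k) :=
  M.brokenSpace P ⊓ (HLambda M.domain k).comap (M.glue k)

/-- The broken tangential traces `Ŵ_h^tan = {v^tan : v ∈ W_h}`. -/
def brokenTraces {k : ℕ} (P : Submodule ℝ (SForm n k)) :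
    Submodule ℝ ((K : M.cells) → BoundaryForm K.1 k) :=
  (M.brokenSpace P).map (M.trace k)

/-- The unbroken tangential traces `V̂_h^tan = {v^tan : v ∈ V_h}`. -/
def femTraces {k : ℕ} (P : Submodule ℝ (SForm n k)) :
    Submodule ℝ ((K : M.cells) → BoundaryForm K.1 k) :=
  (M.femSpace P).map (M.trace k)

/-- `Ŵ_h^nor`, the dual space of `Ŵ_h^tan`. -/
abbrev NormalTraces {k : ℕ} (P : Submodule ℝ (SForm n k)) : Type :=
  Module.Dual ℝ (M.brokenTraces P)

/-- The tangential trace of `v ∈ W_h` as an element of `Ŵ_h^tan`. -/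
def traceOf {k : ℕ} {P : Submodule ℝ (SForm n k)} (v : M.brokenSpace P) : M.brokenTraces P :=
  ⟨M.trace k v.val, Submodule.mem_map_of_mem v.2⟩

/-- The inclusion `V̂_h^tan ⊆ Ŵ_h^tan`. -/
def traceIncl {k : ℕ} (P : Submodule ℝ (SForm n k)) : M.femTraces P →ₗ[ℝ] M.brokenTraces P :=
  Submodule.inclusion (Submodule.map_mono inf_le_left)

variable {k : ℕ} (A : Submodule ℝ (SForm n (k - 1))) (B : Submodule ℝ (SForm n k))

/-- The global discrete harmonic forms `ℌ_h^k`: closed forms in `V_h^k` which are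
`L²(Ω)`-orthogonal to `d V_h^{k-1}`. -/
def harmonic : Submodule ℝ (M.Broken k) where
  carrier := {v | v ∈ M.femSpace B ∧ M.d k v = 0 ∧
    ∀ τ ∈ M.femSpace A, M.inner (M.dPrev k τ) v = 0}
  zero_mem' := ⟨zero_mem _, map_zero _, fun τ _ => by simp [inner]⟩
  add_mem' := by
    rintro v w ⟨h1, h2, h3⟩ ⟨h1', h2', h3'⟩
    refine ⟨add_mem h1 h1', by rw [map_add, h2, h2', add_zero], fun τ hτ => ?_⟩
    have e := h3 τ hτ
    have e' := h3' τ hτ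
    simp only [inner] at e e' ⊢
    simp [Finset.sum_add_distrib, e, e']
  smul_mem' := by
    rintro c v ⟨h1, h2, h3⟩
    refine ⟨Submodule.smul_mem _ c h1, by rw [map_smul, h2, smul_zero], fun τ hτ => ?_⟩
    have e := h3 τ hτ
    simp only [inner] at e ⊢
    simp [← Finset.mul_sum, e]

/-- The space `∏_K ℌ̊_h^k(K)` of piecewise local harmonic forms. -/
def brokenHarmonic : Submodule ℝ (M.Broken k) :=
  Submodule.pi Set.univ fun K => cellHarmonic K.1 A B

end SimplicialMesh

/-! ### The discrete problems -/

/-- A linear problem: a vector space of unknowns (trial functions), and the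
condition on the unknowns expressed by the system of equations. -/
structure DiscreteProblem where
  Unknown : Type
  [addCommGroup : AddCommGroup Unknown]
  [module : Module ℝ Unknown]
  IsSolution : Unknown → Prop

attribute [instance] DiscreteProblem.addCommGroup DiscreteProblem.module

/-- The size of a discrete problem: the dimension of its space of unknowns (as a cardinal, so that no
junk value is involved). -/
def DiscreteProblem.size (S : DiscreteProblem) : Cardinal := Module.rank ℝ S.Unknown

namespace SimplicialMesh

variable {n : ℕ} (M : SimplicialMesh n) {k : ℕ} (A : Submodule ℝ (SForm n (k - 1)))
  (B : Submodule ℝ (SForm n k))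

/-- The standard FEEC system: find `σ ∈ V_h^{k-1}`, `u ∈ V_h^k`, `p ∈ ℌ_h^k` with
`(σ, τ) - (u, dτ) = 0`, `(dσ, v) + (du, dv) + (p, v) = (f, v)` and `(u, q) = 0` for all
`τ ∈ V_h^{k-1}`, `v ∈ V_h^k`, `q ∈ ℌ_h^k`. -/
def feecProblem (f : Euc n → Alt n k) : DiscreteProblem where
  Unknown := M.femSpace A × M.femSpace B × M.harmonic A B
  IsSolution := fun ⟨σ, u, p⟩ =>
    (∀ τ ∈ M.femSpace A, M.inner σ.1 τ - M.inner u.1 (M.dPrev k τ) = 0) ∧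
    (∀ v ∈ M.femSpace B, M.inner (M.dPrev k σ.1) v + M.inner (M.d k u.1) (M.d k v)
      + M.inner p.1 v = M.load f v) ∧
    (∀ q ∈ M.harmonic A B, M.inner u.val q = 0)

/-- The local variables `(σ, u, p̄, û^nor, ρ̂^nor)` of the hybridized problem. -/
structure LocalVars where
  σ : M.brokenSpace A
  u : M.brokenSpace B
  pBar : M.brokenHarmonic A B
  uNor : M.NormalTraces A
  ρNor : M.NormalTraces B

/-- The global variables `(p, ū, σ̂^tan, û^tan)` of the hybridized problem. -/
abbrev GlobalVars : Type :=
  M.harmonic A B × M.brokenHarmonic A B × M.femTraces A × M.femTraces B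

variable {A B}

/-- The symmetric bilinear form `a` of the local solvers. -/
def aForm (x y : M.LocalVars A B) : ℝ :=
  - M.inner x.σ.1 y.σ.1 + M.inner x.u.1 (M.dPrev k y.σ.1) - x.uNor (M.traceOf y.σ)
  + M.inner (M.dPrev k x.σ.1) y.u.1 + M.inner (M.d k x.u.1) (M.d k y.u.1)
  + M.inner x.pBar.1 y.u.1 - x.ρNor (M.traceOf y.u)
  + M.inner x.u.1 y.pBar.1 - y.uNor (M.traceOf x.σ) - y.ρNor (M.traceOf x.u)

/-- The bilinear form `b` coupling local and global variables. -/
def bForm (x : M.LocalVars A B) : M.GlobalVars A B → ℝ := fun ⟨q, vBar, τTan, vTan⟩ =>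
  M.inner x.u.1 q.1 - M.inner x.pBar.1 vBar.1
  + x.uNor (M.traceIncl A τTan) + x.ρNor (M.traceIncl B vTan)

variable (A B)

/-- The hybridized and statically condensed FEEC system. The hybridized problem is to find local
variables `x` and global variables `y` with `a(x, x') + b(x', y) = (f, v')` for all
`x' = (τ', v', …)`, and `b(x, y') = 0` for all `y'`. With the local solutions `X_f` and `X_y` of
`a(X_f, x') = (f, v')` and `a(X_y, x') = -b(x', y)`, the condensed system for the global variables
alone is `b(X_y, y') = -b(X_f, y')` for all `y'`. -/
def condensedProblem (f : Euc n → Alt n k) : DiscreteProblem where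
  Unknown := M.GlobalVars A B
  IsSolution := fun y => ∃ Xf Xy : M.LocalVars A B,
    (∀ x' : M.LocalVars A B, M.aForm Xf x' = M.load f x'.u.1) ∧
    (∀ x' : M.LocalVars A B, M.aForm Xy x' = - M.bForm x' y) ∧
    (∀ y' : M.GlobalVars A B, M.bForm Xy y' = - M.bForm Xf y')

end SimplicialMesh

end FEEC

end

/-!
# When hybridization and condensation reduce the size of the FEEC system

Both systems contain `ℌ_h^k`, so only the other unknowns matter. The tangential trace from `V_h`
to `V̂_h^tan` is onto, and its kernel consists of the `v ∈ V_h` with zero trace on the boundary of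
every element. This kernel is all of `∏_K W̊_h(K)`: integrating by parts on a simplex against a
form with zero tangential trace leaves no boundary term (`integral_altInner_extD`), so such a
broken form has its elementwise exterior derivative as weak exterior derivative
(`zeroTraceSpace_le_femSpace`). By rank and nullity, the condensed system is strictly smaller iff
`dim ∏_K ℌ̊_h^k(K) < dim ∏_K W̊_h^{k-1}(K) + dim ∏_K W̊_h^k(K)` (`size_condensedProblem_lt_iff`).
Since `ℌ̊_h^k(K) ⊆ W̊_h^k(K)`, this fails exactly when `W̊_h^{k-1}(K) = 0` and every form in
`W̊_h^k(K)` is harmonic. The local cohomology is not needed; two facts about one simplex decide.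

* If `k < n` and `r + k ≤ n`, a form in `P_r Λ^k` with zero tangential trace vanishes
  (`cellZeroTrace_polyForms_eq_bot`). Its coefficient on the edges from a vertex to `k` others is
  divisible by the `n - k` barycentric coordinates of the remaining vertices, hence is a constant
  multiple of their product, and the trace on the last facet shows that the constant is zero.
* If `k < n`, then `P_{n-k+1}^- Λ^k` contains a form with zero trace which is not closed
  (`exists_nonclosed_bubble`): `λ_{k+1} ⋯ λ_n` times the Whitney form of the face `a_0, …, a_k`.

For `k < n`, the second fact gives strictness in the asserted range of `r`, and the first fact,
applied in degrees `k - 1` and `k`, gives equality outside it. For `k = n`, all of `W_h^n(K)` has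
zero trace and is closed, so the question is whether `W̊_h^{n-1}(K)` is zero. By the same facts in
degree `n - 1`, this is so iff `r = 0`.

The integration by parts rests on the divergence theorem for fields tangential to the facets. It
is proved with the cutoff functions `∏_j ψ(λ_j / ε)`: the normal components of the field are
`O(λ_j)`, so the gradient of the cutoff contributes a bounded integrand which tends to zero
pointwise as `ε → 0`.
-/

noncomputable section

open MeasureTheory
open scoped ContDiff

namespace FEEC

/-! ### Alternating forms in coordinates -/

theorem sum_smul_stdVec {n : ℕ} (x : Euc n) : ∑ i, x i • stdVec n i = x := by
  simpa [stdVec] using (EuclideanSpace.basisFun (Fin n) ℝ).sum_repr x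

theorem alt_ext_basis {n k : ℕ} {ι : Type*} [Finite ι] (e : Module.Basis ι ℝ (Euc n))
    {α β : Alt n k}
    (h : ∀ v : Fin k → ι, Function.Injective v → α (fun i => e (v i)) = β (fun i => e (v i))) :
    α = β :=
  ContinuousAlternatingMap.toAlternatingMap_injective (e.ext_alternating h)

instance finite_alt (n k : ℕ) : Module.Finite ℝ (Alt n k) := by
  let L : Alt n k →ₗ[ℝ] ((Fin k → Fin n) → ℝ) :=
    { toFun := fun α f => α (fun i => stdVec n (f i))
      map_add' := fun _ _ => rfl
      map_smul' := fun _ _ => rfl }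
  refine Module.Finite.of_injective L fun α β h => ?_
  refine alt_ext_basis (EuclideanSpace.basisFun (Fin n) ℝ).toBasis fun v _ => ?_
  simpa [L, stdVec] using congrFun h v

/-- Summing a symmetric function of `k` indices over all index tuples counts each increasing tuple
`k!` times, once tuples with a repeated index contribute nothing. -/
theorem sum_tuples_eq_factorial_mul {n k : ℕ} (F : (Fin k → Fin n) → ℝ)
    (h0 : ∀ f, ¬ Function.Injective f → F f = 0)
    (hs : ∀ f (σ : Equiv.Perm (Fin k)), F (f ∘ σ) = F f) :
    ∑ f, F f = k.factorial * ∑ I : Fin k ↪o Fin n, F I := by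
  classical
  have e : ∑ f : Fin k → Fin n with Function.Injective f, F f
      = ∑ p : (Fin k ↪o Fin n) × Equiv.Perm (Fin k), F p.1 := by
    symm
    refine Finset.sum_bij (fun p _ => p.1 ∘ p.2) ?_ ?_ ?_ ?_
    · intro p _
      simpa using p.1.injective
    · rintro ⟨I, σ⟩ _ ⟨J, τ⟩ _ h
      have hIJ : I = J := by
        refine DFunLike.coe_injective ((I.strictMono.range_inj J.strictMono).1 ?_)
        have := congrArg Set.range h
        simpa [Set.range_comp] using this
      subst hIJ
      have : σ = τ := Equiv.ext fun i => I.injective (congrFun h i)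
      rw [this]
    · intro f hf
      have hf : Function.Injective f := by simpa using hf
      have hm : StrictMono (f ∘ Tuple.sort f) :=
        (Tuple.monotone_sort f).strictMono_of_injective (hf.comp (Tuple.sort f).injective)
      refine ⟨(OrderEmbedding.ofStrictMono _ hm, (Tuple.sort f)⁻¹), Finset.mem_univ _, ?_⟩
      ext i
      simp
    · rintro ⟨I, σ⟩ _
      exact (hs I σ).symm
  have e' : ∑ f : Fin k → Fin n with Function.Injective f, F f = ∑ f, F f := by
    refine Finset.sum_filter_of_ne fun f _ hf => ?_
    by_contra h
    exact hf (h0 f h)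
  rw [← e', e, Fintype.sum_prod_type]
  simp [Fintype.card_perm, Finset.mul_sum]

theorem factorial_mul_altInner {n k : ℕ} (α β : Alt n k) :
    k.factorial * altInner α β
      = ∑ f : Fin k → Fin n, α (fun i => stdVec n (f i)) * β (fun i => stdVec n (f i)) := by
  symm
  refine sum_tuples_eq_factorial_mul
    (fun f => α (fun i => stdVec n (f i)) * β (fun i => stdVec n (f i))) ?_ ?_
  · intro f hf
    have : ¬ Function.Injective fun i => stdVec n (f i) := fun h => hf (h.of_comp (f := stdVec n))
    simp only [mul_eq_zero]
    exact Or.inl (α.toAlternatingMap.map_eq_zero_of_not_injective _ this)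
  · intro f σ
    have e (γ : Alt n k) : γ (fun i => stdVec n (f (σ i)))
        = Equiv.Perm.sign σ • γ (fun i => stdVec n (f i)) :=
      γ.toAlternatingMap.map_perm (fun i => stdVec n (f i)) σ
    simp only [Function.comp, e]
    rcases Int.units_eq_one_or (Equiv.Perm.sign σ) with h | h <;> simp [h]

/-- Contraction is adjoint to exterior multiplication:
`(∑ᵢ eⁱ ∧ f(eᵢ), β) = ∑ᵢ (f(eᵢ), ι_{eᵢ} β)`. -/
theorem altInner_alternatizeUncurryFin {n k : ℕ} (f : Euc n →L[ℝ] Alt n k) (β : Alt n (k + 1)) :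
    altInner (.alternatizeUncurryFin f) β
      = ∑ i, altInner (f (stdVec n i)) (β.curryLeft (stdVec n i)) := by
  have hk : ((k + 1).factorial : ℝ) ≠ 0 := by positivity
  refine mul_left_cancel₀ hk ?_
  rw [factorial_mul_altInner, Nat.factorial_succ]
  push_cast
  rw [mul_assoc, Finset.mul_sum]
  simp_rw [factorial_mul_altInner]
  -- each of the `k + 1` terms of the alternatization contributes equally
  have key (j : Fin (k + 1)) :
      ∑ g : Fin (k + 1) → Fin n, ((-1) ^ (j : ℕ) * f (stdVec n (g j))
          (j.removeNth fun i => stdVec n (g i))) * β (fun i => stdVec n (g i))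
        = ∑ i, ∑ g : Fin k → Fin n, f (stdVec n i) (fun l => stdVec n (g l)) *
            β.curryLeft (stdVec n i) (fun l => stdVec n (g l)) := by
    rw [← Fintype.sum_prod_type', ← (Fin.insertNthEquiv (fun _ => Fin n) j).sum_comp]
    refine Finset.sum_congr rfl fun p _ => ?_
    obtain ⟨i, g⟩ := p
    have e1 : (fun l => stdVec n ((Fin.insertNthEquiv (fun _ => Fin n) j (i, g)) l))
        = j.insertNth (stdVec n i) (fun l => stdVec n (g l)) := by
      refine (Fin.insertNth_eq_iff.2 ⟨by simp, ?_⟩).symm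
      ext1 l
      simp [Fin.removeNth]
    have e2 := congrFun e1 j
    rw [e1]
    simp only [e2, Fin.insertNth_apply_same, Fin.removeNth_insertNth,
      ContinuousAlternatingMap.map_insertNth]
    rw [ContinuousAlternatingMap.curryLeft_apply_apply, zsmul_eq_mul]
    push_cast
    have : ((-1 : ℝ) ^ (j : ℕ)) * (-1) ^ (j : ℕ) = 1 := by rw [← mul_pow]; simp
    linear_combination (f (stdVec n i) (fun l => stdVec n (g l)) *
      β (Matrix.vecCons (stdVec n i) (fun l => stdVec n (g l)))) * this
  simp only [ContinuousAlternatingMap.alternatizeUncurryFin_apply, Finset.sum_mul, zsmul_eq_mul]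
  push_cast
  rw [Finset.sum_comm]
  simp only [key]
  simp

/-- If `α` vanishes on the hyperplane `ker ℓ`, then `ℓ ∧ α = 0`, so `α` is orthogonal to the
contraction of any form with the vector dual to `ℓ`. The hyperplane is described by a basis all of
whose members but one lie in it. -/
theorem sum_mul_altInner_curryLeft_eq_zero {n k : ℕ} {ι : Type*} [Finite ι]
    (e : Module.Basis ι ℝ (Euc n)) (i₀ : ι) (l : Euc n →L[ℝ] ℝ) (hl : ∀ i ≠ i₀, l (e i) = 0)
    (α : Alt n k) (hα : ∀ w : Fin k → Euc n, (∀ j, l (w j) = 0) → α w = 0) (β : Alt n (k + 1)) :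
    ∑ i, l (stdVec n i) * altInner α (β.curryLeft (stdVec n i)) = 0 := by
  have h0 : ContinuousAlternatingMap.alternatizeUncurryFin (l.smulRight α) = 0 := by
    refine alt_ext_basis e fun v hv => ?_
    rw [ContinuousAlternatingMap.alternatizeUncurryFin_apply]
    refine Finset.sum_eq_zero fun j _ => ?_
    by_cases hj : v j = i₀
    · have : α (j.removeNth fun i => e (v i)) = 0 :=
        hα _ fun m => hl _ fun h => j.succAbove_ne m (hv (h.trans hj.symm))
      simp [this]
    · simp [hl _ hj]
  have h := altInner_alternatizeUncurryFin (l.smulRight α) β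
  simp only [h0, ContinuousLinearMap.smulRight_apply, altInner_smul_left] at h
  rw [← h]
  simp [altInner]

/-! ### Polynomial forms: degrees and dimensions -/

theorem polyForms_induction {n r k : ℕ} {p : SForm n k → Prop} {φ : SForm n k}
    (hφ : φ ∈ polyForms n r k)
    (hgen : ∀ (φ : SForm n k) (q : MvPolynomial (Fin n) ℝ) (α : Alt n k), q.totalDegree ≤ r →
      (∀ x : Euc n, φ.val x = MvPolynomial.eval (fun i => x i) q • α) → p φ)
    (h0 : p 0) (hadd : ∀ φ ψ, p φ → p ψ → p (φ + ψ)) (hsmul : ∀ (c : ℝ) φ, p φ → p (c • φ)) :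
    p φ := by
  refine Submodule.span_induction ?_ h0 (fun φ ψ _ _ => hadd φ ψ) (fun c φ _ => hsmul c φ) hφ
  rintro φ ⟨q, α, hq, h⟩
  exact hgen φ q α hq h

theorem contDiff_eval {n : ℕ} (q : MvPolynomial (Fin n) ℝ) :
    ContDiff ℝ ∞ (fun x : Euc n => MvPolynomial.eval (fun i => x i) q) := by
  induction q using MvPolynomial.induction_on with
  | C a => simpa using contDiff_const
  | add p q hp hq => simpa using hp.add hq
  | mul_X p i hp =>
    simp only [map_mul, MvPolynomial.eval_X]
    exact hp.mul (EuclideanSpace.proj (𝕜 := ℝ) i).contDiff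

/-- The form `q α`, for a polynomial `q` and a constant form `α`, bilinearly in `q` and `α`. -/
def polySMul (n k : ℕ) : MvPolynomial (Fin n) ℝ →ₗ[ℝ] Alt n k →ₗ[ℝ] SForm n k :=
  LinearMap.mk₂ ℝ
    (fun q α => .mk (fun x => MvPolynomial.eval (fun i => x i) q • α)
      ((contDiff_eval q).smul contDiff_const))
    (fun q q' α => SForm.ext fun x => by simp [add_smul])
    (fun c q α => SForm.ext fun x => by simp [mul_smul])
    (fun q α α' => SForm.ext fun x => by simp)
    (fun c q α => SForm.ext fun x => by simp [smul_comm c])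

@[simp] theorem polySMul_val {n k : ℕ} (q : MvPolynomial (Fin n) ℝ) (α : Alt n k) (x : Euc n) :
    (polySMul n k q α).val x = MvPolynomial.eval (fun i => x i) q • α := rfl

theorem polySMul_mem {n k r : ℕ} {q : MvPolynomial (Fin n) ℝ} (hq : q.totalDegree ≤ r)
    (α : Alt n k) : polySMul n k q α ∈ polyForms n r k :=
  Submodule.subset_span ⟨q, α, hq, fun _ => rfl⟩

instance finite_polyForms (n r k : ℕ) : Module.Finite ℝ (polyForms n r k) := by
  have h : polyForms n r k ≤
      Submodule.map₂ (polySMul n k) (MvPolynomial.restrictTotalDegree (Fin n) ℝ r) ⊤ := by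
    refine Submodule.span_le.2 ?_
    rintro φ ⟨q, α, hq, hφ⟩
    have : φ = polySMul n k q α := SForm.ext hφ
    rw [this]
    exact Submodule.apply_mem_map₂ _ ((MvPolynomial.mem_restrictTotalDegree _ _ _).2 hq) trivial
  have hf : (MvPolynomial.restrictTotalDegree (Fin n) ℝ r).FG := by
    rw [MvPolynomial.restrictTotalDegree, MvPolynomial.restrictSupport_eq_span]
    refine Submodule.fg_def.2 ⟨_, Set.Finite.image _ ?_, rfl⟩
    exact Finsupp.finite_of_degree_le r
  have : Module.Finite ℝ (Submodule.map₂ (polySMul n k)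
      (MvPolynomial.restrictTotalDegree (Fin n) ℝ r) ⊤) :=
    Module.Finite.iff_fg.2 (hf.map₂ _ Module.Finite.fg_top)
  exact Submodule.finiteDimensional_of_le h

theorem polyForms_mono {n r r' : ℕ} (k : ℕ) (h : r ≤ r') : polyForms n r k ≤ polyForms n r' k :=
  Submodule.span_mono fun _ ⟨q, α, hq, hφ⟩ => ⟨q, α, hq.trans h, hφ⟩

theorem map_koszul_polyForms_le (n r k : ℕ) :
    (polyForms n r (k + 1)).map (koszul n k) ≤ polyForms n (r + 1) k := by
  rw [polyForms, Submodule.map_span_le]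
  rintro φ ⟨q, α, hq, hφ⟩
  have : koszul n k φ
      = ∑ i, polySMul n k (q * MvPolynomial.X i) (α.curryLeft (stdVec n i)) := by
    refine SForm.ext fun x => ?_
    have hs : (∑ i, polySMul n k (q * MvPolynomial.X i) (α.curryLeft (stdVec n i))).val x
        = ∑ i, (MvPolynomial.eval (fun i => x i) q * x i) • α.curryLeft (stdVec n i) := by
      have : ∀ s : Finset (Fin n),
          (∑ i ∈ s, polySMul n k (q * MvPolynomial.X i) (α.curryLeft (stdVec n i))).val x
          = ∑ i ∈ s, (MvPolynomial.eval (fun i => x i) q * x i) • α.curryLeft (stdVec n i) := by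
        intro s
        induction s using Finset.induction_on with
        | empty => simp
        | insert a s ha ih => simp [Finset.sum_insert ha, ih]
      exact this _
    rw [hs]
    change (φ.val x).curryLeft x = _
    rw [hφ]
    have hx : α.curryLeft x = ∑ i, x i • α.curryLeft (stdVec n i) := by
      conv_lhs => rw [← sum_smul_stdVec x, map_sum]
      simp
    simp_rw [mul_smul, ← Finset.smul_sum, ← hx]
    rfl
  rw [this]
  refine Submodule.sum_mem _ fun i _ => polySMul_mem ?_ _
  exact (MvPolynomial.totalDegree_mul _ _).trans (by simpa using hq)

theorem trimmedForms_le_polyForms (n r k : ℕ) : trimmedForms n r k ≤ polyForms n r k := by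
  cases r with
  | zero => exact bot_le
  | succ r => exact sup_le (polyForms_mono k r.le_succ) (map_koszul_polyForms_le n r k)

theorem trimmedForms_mono {n r r' : ℕ} (k : ℕ) (h : r ≤ r') :
    trimmedForms n r k ≤ trimmedForms n r' k := by
  cases r with
  | zero => exact bot_le
  | succ r =>
    obtain ⟨r', rfl⟩ : ∃ m, r' = m + 1 := ⟨r' - 1, by omega⟩
    have h : r ≤ r' := by omega
    exact sup_le_sup (polyForms_mono k h) (Submodule.map_mono (polyForms_mono _ h))

theorem trimmedForms_le_elementForms (n r k : ℕ) (s : Family) :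
    trimmedForms n r k ≤ elementForms n s r k := by
  cases s with
  | full => exact trimmedForms_le_polyForms n r k
  | trimmed => exact le_rfl

theorem elementForms_le_polyForms (n r k : ℕ) (s : Family) :
    elementForms n s r k ≤ polyForms n r k := by
  cases s with
  | full => exact le_rfl
  | trimmed => exact trimmedForms_le_polyForms n r k

instance finite_elementForms (n r k : ℕ) (s : Family) :
    Module.Finite ℝ (elementForms n s r k) :=
  Submodule.finiteDimensional_of_le (elementForms_le_polyForms n r k s)

instance finite_sigmaElement (n r k : ℕ) (s : Family) :
    Module.Finite ℝ (sigmaElement n r k s) := by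
  cases k with
  | zero => exact inferInstanceAs (Module.Finite ℝ (⊥ : Submodule ℝ (SForm n 0)))
  | succ k => exact finite_elementForms n (r + 1) k s

instance finite_uElement (n r k : ℕ) (t : Family) : Module.Finite ℝ (uElement n r k t) := by
  cases t with
  | full => exact finite_elementForms n r k .full
  | trimmed => exact finite_elementForms n (r + 1) k .trimmed

/-! ### Barycentric coordinates and zero traces -/

section Simplex

variable {n : ℕ} (b : AffineBasis (Fin (n + 1)) ℝ (Euc n))

/-- The differential `dλ_j` of the barycentric coordinate `λ_j`. -/
def dbary (j : Fin (n + 1)) : Euc n →L[ℝ] ℝ := LinearMap.toContinuousLinearMap (b.coord j).linear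

theorem dbary_sub (j : Fin (n + 1)) (x y : Euc n) :
    dbary b j (x - y) = b.coord j x - b.coord j y := by
  simpa [dbary] using (b.coord j).linearMap_vsub x y

theorem coord_add (j : Fin (n + 1)) (x w : Euc n) :
    b.coord j (x + w) = b.coord j x + dbary b j w := by
  have := dbary_sub b j (x + w) x
  rw [add_sub_cancel_left] at this
  linarith

theorem dbary_vertex_sub (j i m : Fin (n + 1)) :
    dbary b j (b i - b m) = (if j = i then 1 else 0) - (if j = m then 1 else 0) := by
  rw [dbary_sub, b.coord_apply, b.coord_apply]

theorem sum_dbary_smul (w : Euc n) : ∑ i, dbary b i w • b i = w := by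
  have h1 := b.linear_combination_coord_eq_self w
  have h2 := b.linear_combination_coord_eq_self (0 : Euc n)
  calc ∑ i, dbary b i w • b i = ∑ i, b.coord i w • b i - ∑ i, b.coord i 0 • b i := by
        rw [← Finset.sum_sub_distrib]
        refine Finset.sum_congr rfl fun i _ => ?_
        rw [← sub_smul, ← dbary_sub, sub_zero]
    _ = w := by rw [h1, h2, sub_zero]

theorem sum_dbary (w : Euc n) : ∑ i, dbary b i w = 0 := by
  have h1 := b.sum_coord_apply_eq_one w
  have h2 := b.sum_coord_apply_eq_one (0 : Euc n)
  calc ∑ i, dbary b i w = ∑ i, b.coord i w - ∑ i, b.coord i 0 := by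
        rw [← Finset.sum_sub_distrib]
        refine Finset.sum_congr rfl fun i _ => ?_
        rw [← dbary_sub, sub_zero]
    _ = 0 := by rw [h1, h2, sub_self]

theorem range_diff_vertex (j : Fin (n + 1)) : Set.range b \ {b j} = b '' {i | i ≠ j} := by
  ext x
  constructor
  · rintro ⟨⟨i, rfl⟩, h⟩
    exact ⟨i, fun e => h (by simp [e]), rfl⟩
  · rintro ⟨i, hi, rfl⟩
    exact ⟨⟨i, rfl⟩, fun h => hi (b.ind.injective h)⟩

theorem convexHull_facet (j : Fin (n + 1)) :
    convexHull ℝ (Set.range b \ {b j}) = {x | (∀ i, 0 ≤ b.coord i x) ∧ b.coord j x = 0} := by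
  rw [range_diff_vertex]
  apply Set.Subset.antisymm
  · intro x hx
    refine ⟨?_, ?_⟩
    · have : x ∈ convexHull ℝ (Set.range b) := convexHull_mono (Set.image_subset_range _ _) hx
      rwa [b.convexHull_eq_nonneg_coord] at this
    · have hc : Convex ℝ (b.coord j ⁻¹' {0}) := (convex_singleton 0).affine_preimage _
      refine convexHull_min ?_ hc hx
      rintro _ ⟨i, hi, rfl⟩
      exact b.coord_apply_ne (Ne.symm hi)
  · rintro x ⟨h0, hj⟩
    have e : ∑ i ∈ Finset.univ.erase j, b.coord i x • b i = x := by
      rw [Finset.sum_erase _ (by simp [hj]), b.linear_combination_coord_eq_self]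
    have e1 : ∑ i ∈ Finset.univ.erase j, b.coord i x = 1 := by
      rw [Finset.sum_erase (f := fun i => b.coord i x) _ hj, b.sum_coord_apply_eq_one]
    rw [← e]
    exact (convex_convexHull ℝ _).sum_mem (fun i _ => h0 i) e1 fun i hi =>
      subset_convexHull ℝ _ ⟨i, by simpa using hi, rfl⟩

theorem mem_vectorSpan_facet (hn : 1 ≤ n) (j : Fin (n + 1)) (w : Euc n) :
    w ∈ vectorSpan ℝ (Set.range b \ {b j}) ↔ dbary b j w = 0 := by
  rw [range_diff_vertex]
  constructor
  · intro hw
    refine Submodule.span_induction ?_ (map_zero _) ?_ ?_ hw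
    · rintro _ ⟨_, ⟨i, hi, rfl⟩, _, ⟨m, hm, rfl⟩, rfl⟩
      simp only [vsub_eq_sub, dbary_vertex_sub]
      simp [Ne.symm hi, Ne.symm hm]
    · intro x y _ _ hx hy
      rw [map_add, hx, hy, add_zero]
    · intro c x _ hx
      rw [map_smul, hx, smul_zero]
  · intro hw
    have : Nontrivial (Fin (n + 1)) := Fin.nontrivial_iff_two_le.2 (by omega)
    obtain ⟨m, hm⟩ := exists_ne j
    have e : w = ∑ i, dbary b i w • (b i - b m) := by
      simp_rw [smul_sub]
      rw [Finset.sum_sub_distrib, ← Finset.sum_smul, sum_dbary, sum_dbary_smul, zero_smul, sub_zero]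
    rw [e]
    refine Submodule.sum_mem _ fun i _ => ?_
    by_cases hi : i = j
    · simp [hi, hw]
    · exact Submodule.smul_mem _ _ (vsub_mem_vectorSpan ℝ ⟨i, hi, rfl⟩ ⟨m, hm, rfl⟩)

/-- Vanishing of the tangential trace, in barycentric coordinates: on the facet `λ_j = 0`, the form
vanishes on all tuples of vectors in `ker dλ_j`. -/
theorem cellTrace_eq_zero_iff {k : ℕ} (hn : 1 ≤ n) {s : Finset (Euc n)} (hs : Set.range b = s)
    (φ : SForm n k) :
    cellTrace s φ = 0 ↔ ∀ j x, (∀ i, 0 ≤ b.coord i x) → b.coord j x = 0 →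
      ∀ w : Fin k → Euc n, (∀ l, dbary b j (w l) = 0) → φ.val x w = 0 := by
  constructor
  · intro h j x hx hj w hw
    have hbj : b j ∈ s := by
      have : b j ∈ (s : Set (Euc n)) := hs ▸ Set.mem_range_self j
      exact this
    have hx' : x ∈ convexHull ℝ ((s : Set (Euc n)) \ {b j}) := by
      rw [← hs, convexHull_facet]
      exact ⟨hx, hj⟩
    have hw' (l) : w l ∈ vectorSpan ℝ ((s : Set (Euc n)) \ {b j}) := by
      rw [← hs, mem_vectorSpan_facet b hn]
      exact hw l
    exact congrArg (fun α => α (fun l => ⟨w l, hw' l⟩)) (congrFun (congrFun h ⟨b j, hbj⟩) ⟨x, hx'⟩)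
  · intro h
    funext ⟨a, ha⟩ ⟨x, hx⟩
    ext w
    have ha : a ∈ (s : Set (Euc n)) := ha
    rw [← hs] at ha
    obtain ⟨j, rfl⟩ := ha
    have hx' := hx
    rw [← hs, convexHull_facet] at hx'
    refine h j x hx'.1 hx'.2 (fun l => (w l : Euc n)) fun l => ?_
    have := (w l).2
    simp only [← hs] at this
    exact (mem_vectorSpan_facet b hn j _).1 this

/-- The edge vectors at the vertex `0` form a basis. -/
def edgeBasis : Module.Basis (Fin n) ℝ (Euc n) :=
  (b.basisOf 0).reindex (finSuccAboveEquiv 0).symm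

theorem edgeBasis_apply (i : Fin n) : edgeBasis b i = b i.succ - b 0 := by
  simp only [edgeBasis, Module.Basis.reindex_apply, Equiv.symm_symm, AffineBasis.basisOf_apply,
    vsub_eq_sub, finSuccAboveEquiv_apply, Fin.succAbove_zero]

/-- The point `a_0 + ∑ y_l (a_{l+1} - a_0)`, with barycentric coordinates `y` at the vertices other
than `0`. -/
def baryPoint (y : Fin n → ℝ) : Euc n := b 0 + ∑ l, y l • (b l.succ - b 0)

theorem coord_baryPoint_succ (y : Fin n → ℝ) (i : Fin n) :
    b.coord i.succ (baryPoint b y) = y i := by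
  rw [baryPoint, coord_add, map_sum]
  simp [dbary_vertex_sub, b.coord_apply]

theorem coord_baryPoint_zero (y : Fin n → ℝ) :
    b.coord 0 (baryPoint b y) = 1 - ∑ i, y i := by
  have := b.sum_coord_apply_eq_one (baryPoint b y)
  rw [Fin.sum_univ_succ] at this
  simp only [coord_baryPoint_succ] at this
  linarith

theorem baryPoint_coord (x : Euc n) : baryPoint b (fun i => b.coord i.succ x) = x := by
  refine b.ext_elem fun i => ?_
  refine Fin.cases ?_ (fun i => ?_) i
  · rw [coord_baryPoint_zero]
    have := b.sum_coord_apply_eq_one x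
    rw [Fin.sum_univ_succ] at this
    linarith
  · rw [coord_baryPoint_succ]

end Simplex

/-! ### Polynomial forms of low degree with zero trace vanish -/

theorem totalDegree_bind₁_le {σ τ : Type*} (f : σ → MvPolynomial τ ℝ)
    (hf : ∀ i, (f i).totalDegree ≤ 1) (q : MvPolynomial σ ℝ) :
    (MvPolynomial.bind₁ f q).totalDegree ≤ q.totalDegree := by
  rw [MvPolynomial.bind₁, MvPolynomial.aeval_def, MvPolynomial.eval₂_eq]
  refine MvPolynomial.totalDegree_finsetSum_le fun m hm => ?_
  refine (MvPolynomial.totalDegree_mul _ _).trans ?_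
  rw [MvPolynomial.algebraMap_eq, MvPolynomial.totalDegree_C, zero_add]
  refine (MvPolynomial.totalDegree_finsetProd _ _).trans ?_
  refine le_trans ?_ (MvPolynomial.le_totalDegree hm)
  refine Finset.sum_le_sum fun i _ => ?_
  refine (MvPolynomial.totalDegree_pow _ _).trans ?_
  exact (Nat.mul_le_mul_left _ (hf i)).trans (by simp)

theorem exists_affinePoly {m : ℕ} (c : ℝ) (a : Fin m → ℝ) :
    ∃ p : MvPolynomial (Fin m) ℝ, p.totalDegree ≤ 1 ∧
      ∀ y, MvPolynomial.eval y p = c + ∑ l, y l * a l := by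
  refine ⟨.C c + ∑ l, .X l * .C (a l), ?_, fun y => by simp⟩
  refine (MvPolynomial.totalDegree_add _ _).trans (max_le (by simp) ?_)
  refine MvPolynomial.totalDegree_finsetSum_le fun l _ => ?_
  refine (MvPolynomial.totalDegree_mul _ _).trans (by simp)

/-- In affine coordinates, the coefficients of a form in `P_r Λ^k` are polynomials of degree at most
`r`. -/
theorem exists_poly_coeff {n r k : ℕ} {φ : SForm n k} (hφ : φ ∈ polyForms n r k)
    (b : AffineBasis (Fin (n + 1)) ℝ (Euc n)) (w : Fin k → Euc n) :
    ∃ p : MvPolynomial (Fin n) ℝ, p.totalDegree ≤ r ∧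
      ∀ y, MvPolynomial.eval y p = φ.val (baryPoint b y) w := by
  refine polyForms_induction (p := fun φ => ∃ p : MvPolynomial (Fin n) ℝ, p.totalDegree ≤ r ∧
    ∀ y, MvPolynomial.eval y p = φ.val (baryPoint b y) w) hφ (fun φ q α hq h => ?_) ?_ ?_ ?_
  · choose f hf hf' using fun i : Fin n =>
      exists_affinePoly (b 0 i) (fun l => (b l.succ - b 0) i)
    refine ⟨MvPolynomial.bind₁ f q * .C (α w), ?_, fun y => ?_⟩
    · refine (MvPolynomial.totalDegree_mul _ _).trans ?_
      rw [MvPolynomial.totalDegree_C, add_zero]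
      exact (totalDegree_bind₁_le f hf q).trans hq
    · have e : (fun i => MvPolynomial.eval y (f i)) = fun i => (baryPoint b y) i := by
        funext i
        simp [hf', baryPoint]
      have e' : MvPolynomial.eval y (MvPolynomial.bind₁ f q)
          = MvPolynomial.eval (fun i => MvPolynomial.eval y (f i)) q :=
        MvPolynomial.eval₂Hom_bind₁ _ _ _ _
      rw [h, map_mul, MvPolynomial.eval_C, e', e]
      rfl
  · exact ⟨0, by simp, by simp⟩
  · rintro φ ψ ⟨p, hp, hp'⟩ ⟨q, hq, hq'⟩
    exact ⟨p + q, (MvPolynomial.totalDegree_add _ _).trans (max_le hp hq),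
      fun y => by simp [hp', hq']⟩
  · rintro c φ ⟨p, hp, hp'⟩
    exact ⟨c • p, (MvPolynomial.totalDegree_smul_le _ _).trans hp, fun y => by simp [hp']⟩

/-- A polynomial which vanishes on the facet `y_j = 0` of the standard simplex is divisible by
`X_j`. -/
theorem one_le_of_mem_support {n : ℕ} {p : MvPolynomial (Fin n) ℝ} {j : Fin n}
    (h : ∀ y : Fin n → ℝ, (∀ i, 0 ≤ y i) → ∑ i, y i ≤ 1 → y j = 0 → MvPolynomial.eval y p = 0)
    {m : Fin n →₀ ℕ} (hm : m ∈ p.support) : 1 ≤ m j := by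
  classical
  by_contra hmj
  have hmj : m j = 0 := by omega
  -- the part of `p` that does not involve `X_j`
  set p' : MvPolynomial (Fin n) ℝ :=
    ∑ d ∈ p.support with d j = 0, MvPolynomial.monomial d (p.coeff d) with hp'
  have hev (y : Fin n → ℝ) : MvPolynomial.eval y p'
      = MvPolynomial.eval (Function.update y j 0) p := by
    rw [MvPolynomial.eval_eq' _ p, hp', map_sum, Finset.sum_filter]
    refine Finset.sum_congr rfl fun d _ => ?_
    split_ifs with hd
    · rw [MvPolynomial.eval_monomial, Finsupp.prod_fintype _ _ (by simp)]
      congr 1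
      refine Finset.prod_congr rfl fun i _ => ?_
      by_cases hi : i = j
      · subst hi; simp [hd]
      · simp [Function.update_of_ne hi]
    · rw [Finset.prod_eq_zero (Finset.mem_univ j) (by simp [hd]), mul_zero]
  have h0 : p' = 0 := by
    refine MvPolynomial.funext_set (fun _ => Set.Icc 0 ((n : ℝ)⁻¹)) (fun i => ?_) fun y hy => ?_
    · have : 0 < (n : ℝ) := by exact_mod_cast i.pos
      exact Set.Icc_infinite (inv_pos.2 this)
    · have hn : 0 < (n : ℝ) := by exact_mod_cast j.pos
      have hy' (i) : 0 ≤ Function.update y j 0 i ∧ Function.update y j 0 i ≤ (n : ℝ)⁻¹ := by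
        by_cases hi : i = j
        · subst hi; simp
        · simpa [Function.update_of_ne hi] using hy i trivial
      rw [hev, map_zero]
      refine h _ (fun i => (hy' i).1) ?_ (by simp)
      refine (Finset.sum_le_sum fun i _ => (hy' i).2).trans ?_
      simp [hn.ne']
  have hc := congrArg (MvPolynomial.coeff m) h0
  rw [hp', MvPolynomial.coeff_sum, MvPolynomial.coeff_zero] at hc
  simp only [MvPolynomial.coeff_monomial] at hc
  rw [Finset.sum_ite_eq', if_pos (Finset.mem_filter.2 ⟨hm, hmj⟩)] at hc
  exact MvPolynomial.mem_support_iff.1 hm hc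

theorem cellZeroTrace_polyForms_eq_bot {n r k : ℕ} (hk : k < n) (hr : r + k ≤ n)
    (b : AffineBasis (Fin (n + 1)) ℝ (Euc n)) {s : Finset (Euc n)} (hs : Set.range b = s) :
    cellZeroTrace s (polyForms n r k) = ⊥ := by
  classical
  refine (Submodule.eq_bot_iff _).2 fun φ ⟨hφ, ht⟩ => ?_
  have ht := (cellTrace_eq_zero_iff b (by omega) hs φ).1 ht
  -- it suffices that the coefficients on tuples of distinct edges at the vertex `0` vanish
  suffices H : ∀ I : Fin k → Fin n, Function.Injective I → ∀ y,
      φ.val (baryPoint b y) (fun l => edgeBasis b (I l)) = 0 by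
    refine SForm.ext fun x => alt_ext_basis (edgeBasis b) fun I hI => ?_
    rw [← baryPoint_coord b x]
    exact H I hI _
  intro I hI
  obtain ⟨p, hp, hp'⟩ := exists_poly_coeff hφ b (fun l => edgeBasis b (I l))
  suffices hp0 : p = 0 by intro y; rw [← hp', hp0, map_zero]
  have hdim : (Finset.univ.image I).card = k := by
    rw [Finset.card_image_of_injective _ hI, Finset.card_univ, Fintype.card_fin]
  set S := Finset.univ \ Finset.univ.image I with hS
  have hScard : S.card = n - k := by
    rw [hS, Finset.card_sdiff_of_subset (Finset.subset_univ _), hdim, Finset.card_univ,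
      Fintype.card_fin]
  have hmemS (j : Fin n) : j ∈ S ↔ ∀ l, I l ≠ j := by simp [hS]
  have hnn (y : Fin n → ℝ) (hy : ∀ i, 0 ≤ y i) (hy1 : ∑ i, y i ≤ 1) (i : Fin (n + 1)) :
      0 ≤ b.coord i (baryPoint b y) := by
    refine Fin.cases ?_ (fun i => ?_) i
    · rw [coord_baryPoint_zero]; linarith
    · rw [coord_baryPoint_succ]; exact hy i
  -- the coefficient is a multiple of the product of the `y_j`, `j ∉ I`
  have hsupp : ∀ m ∈ p.support, ∀ j, m j = if j ∈ S then 1 else 0 := by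
    intro m hm
    have h1 : ∀ j ∈ S, 1 ≤ m j := by
      intro j hj
      refine one_le_of_mem_support (fun y hy hy1 hyj => ?_) hm
      rw [hp']
      refine ht j.succ _ (hnn y hy hy1) (by rw [coord_baryPoint_succ, hyj]) _ fun l => ?_
      have := (hmemS j).1 hj l
      rw [edgeBasis_apply, dbary_vertex_sub]
      simp [Ne.symm this]
    have h2 : ∑ j, m j ≤ n - k := by
      have := (MvPolynomial.le_totalDegree hm).trans hp
      rw [Finsupp.sum_fintype _ _ (by simp)] at this
      omega
    have h3 : ∑ j, (if j ∈ S then 1 else 0) = n - k := by simp [hScard]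
    have h4 : ∀ j ∈ Finset.univ, (if j ∈ S then 1 else 0) ≤ m j := by
      intro j _
      split_ifs with h
      · exact h1 j h
      · exact Nat.zero_le _
    have h5 := (Finset.sum_eq_sum_iff_of_le h4).1 (le_antisymm (Finset.sum_le_sum h4) (h3 ▸ h2))
    exact fun j => (h5 j (Finset.mem_univ _)).symm
  -- evaluation at the barycenter of the face spanned by the vertices `j + 1`, `j ∉ I`
  set y : Fin n → ℝ := fun i => if i ∈ S then ((n - k : ℕ) : ℝ)⁻¹ else 0 with hy
  have hpos : 0 < ((n - k : ℕ) : ℝ) := by exact_mod_cast Nat.sub_pos_of_lt hk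
  have hy0 : ∀ i, 0 ≤ y i := fun i => by
    simp only [hy]; split_ifs <;> positivity
  have hysum : ∑ i, y i = 1 := by
    simp [hy, hScard, hpos.ne']
  have hIy (l : Fin k) : y (I l) = 0 := by
    have : I l ∉ S := by simp [hS]
    simp [hy, this]
  obtain ⟨j, hj⟩ : S.Nonempty := Finset.card_pos.1 (by omega)
  have hjI := (hmemS j).1 hj
  have hval : MvPolynomial.eval y p = 0 := by
    rw [hp']
    -- on the facet opposite to `0`, the form vanishes on the edges at the vertex `j + 1`
    have hface : φ.val (baryPoint b y) (fun l => edgeBasis b (I l) + -edgeBasis b j) = 0 := by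
      refine ht 0 _ (hnn y hy0 hysum.le) (by rw [coord_baryPoint_zero, hysum, sub_self]) _
        fun l => ?_
      rw [map_add, map_neg, edgeBasis_apply, edgeBasis_apply, dbary_vertex_sub, dbary_vertex_sub]
      simp [(Fin.succ_ne_zero _).symm]
    have hexp := (φ.val (baryPoint b y)).toMultilinearMap.map_add_univ
      (fun l => edgeBasis b (I l)) (fun _ => -edgeBasis b j)
    rw [Finset.sum_eq_single Finset.univ] at hexp
    · rw [Finset.piecewise_univ] at hexp
      exact hexp.symm.trans hface
    · -- if the edge `I l` is replaced, all the edges are tangent to the facet opposite to `I l`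
      intro t _ ht'
      obtain ⟨l, hl⟩ : ∃ l, l ∉ t := by
        by_contra! h
        exact ht' (Finset.eq_univ_iff_forall.2 h)
      refine ht (I l).succ _ (hnn y hy0 hysum.le) (by rw [coord_baryPoint_succ, hIy]) _
        fun l' => ?_
      by_cases hl' : l' ∈ t
      · have : I l ≠ I l' := fun h => hl (hI h ▸ hl')
        rw [Finset.piecewise_eq_of_mem _ _ _ hl', edgeBasis_apply, dbary_vertex_sub]
        simp [this]
      · rw [Finset.piecewise_eq_of_notMem _ _ _ hl', map_neg, edgeBasis_apply, dbary_vertex_sub]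
        simp [hjI l]
    · simp
  by_contra hp0
  obtain ⟨m, hm⟩ := MvPolynomial.support_nonempty.2 hp0
  have hsingle : p.support = {m} := by
    refine Finset.eq_singleton_iff_unique_mem.2 ⟨hm, fun m' hm' => ?_⟩
    ext j
    rw [hsupp m' hm', hsupp m hm]
  rw [MvPolynomial.eval_eq', hsingle, Finset.sum_singleton] at hval
  rcases mul_eq_zero.1 hval with h | h
  · exact MvPolynomial.mem_support_iff.1 hm h
  · obtain ⟨i, _, hi⟩ := Finset.prod_eq_zero_iff.1 h
    rw [hsupp m hm] at hi
    by_cases hiS : i ∈ S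
    · simp [hiS, hy] at hi
      omega
    · simp [hiS] at hi

/-! ### A form with zero trace which is not closed -/

section Bubble

variable {n : ℕ} (b : AffineBasis (Fin (n + 1)) ℝ (Euc n))

/-- The constant form `dλ_0 ∧ ⋯ ∧ dλ_k`, as a determinant. -/
def wedgeBary {k : ℕ} (hk : k < n) : Alt n (k + 1) :=
  { (Matrix.detRowAlternating (R := ℝ) (n := Fin (k + 1))).compLinearMap
      (LinearMap.pi fun i : Fin (k + 1) =>
        (dbary b (Fin.castLE (by omega) i)).toLinearMap) with
    cont := by
      refine Continuous.matrix_det (A := fun v : Fin (k + 1) → Euc n =>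
        Matrix.of fun l (i : Fin (k + 1)) => dbary b (Fin.castLE (by omega) i) (v l)) ?_
      refine continuous_matrix fun l i => ?_
      exact (dbary b (Fin.castLE (by omega) i)).continuous.comp
        (continuous_apply (A := fun _ : Fin (k + 1) => Euc n) l) }

theorem wedgeBary_apply {k : ℕ} (hk : k < n) (v : Fin (k + 1) → Euc n) :
    wedgeBary b hk v
      = Matrix.det (Matrix.of fun l (i : Fin (k + 1)) =>
          dbary b (Fin.castLE (by omega) i) (v l)) := rfl

theorem exists_poly_coord (j : Fin (n + 1)) :
    ∃ p : MvPolynomial (Fin n) ℝ, p.totalDegree ≤ 1 ∧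
      ∀ x : Euc n, MvPolynomial.eval (fun i => x i) p = b.coord j x := by
  obtain ⟨p, hp, hp'⟩ := exists_affinePoly (b.coord j 0) (fun l => dbary b j (stdVec n l))
  refine ⟨p, hp, fun x => ?_⟩
  have h := coord_add b j 0 x
  rw [zero_add] at h
  rw [hp', h]
  conv_rhs => rw [← sum_smul_stdVec x, map_sum]
  simp

/-- The product `λ_{k+1} ⋯ λ_n` is a polynomial of degree at most `n - k`. -/
theorem exists_poly_prod_coord (k : ℕ) :
    ∃ p : MvPolynomial (Fin n) ℝ, p.totalDegree ≤ n - k ∧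
      ∀ x : Euc n, MvPolynomial.eval (fun i => x i) p
        = ∏ j : Fin (n + 1) with k < j.1, b.coord j x := by
  choose f hf hf' using exists_poly_coord b
  refine ⟨∏ j : Fin (n + 1) with k < j.1, f j, ?_, fun x => by simp [map_prod, hf']⟩
  refine (MvPolynomial.totalDegree_finsetProd _ _).trans ?_
  refine (Finset.sum_le_sum fun j _ => hf j).trans ?_
  rw [Finset.sum_const, smul_eq_mul, mul_one]
  have : (Finset.univ.filter fun j : Fin (n + 1) => k < j.1).card ≤ (Finset.Ioc k n).card := by
    refine Finset.card_le_card_of_injOn (fun j => j.1) (fun j hj => ?_)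
      (fun i _ j _ h => Fin.ext h)
    have := j.2
    simp at hj ⊢
    omega
  simpa using this

/-- The form `λ_{k+1} ⋯ λ_n ι_{x - a_n} (dλ_0 ∧ ⋯ ∧ dλ_k)`, the product of the Whitney form of the
face spanned by `a_0, …, a_k` and the barycentric coordinates of the remaining vertices. It has zero
trace, belongs to `P_{n-k+1}^- Λ^k`, and is not closed: on the face spanned by `a_{k+1}, …, a_n` its
differential is `(k + 1) λ_{k+1} ⋯ λ_n dλ_0 ∧ ⋯ ∧ dλ_k`. -/
theorem exists_nonclosed_bubble {k : ℕ} (hk : k < n) {s : Finset (Euc n)} (hs : Set.range b = s) :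
    ∃ φ ∈ trimmedForms n (n - k + 1) k, cellTrace s φ = 0 ∧ extD n k φ ≠ 0 := by
  obtain ⟨q, hq, hq'⟩ := exists_poly_prod_coord b k
  set α := wedgeBary b hk with hα
  set a := b (Fin.last n) with ha
  set φ : SForm n k := koszul n k (polySMul n (k + 1) q α) - polySMul n k q (α.curryLeft a) with hφ
  have hval (x : Euc n) : φ.val x = MvPolynomial.eval (fun i => x i) q • α.curryLeft (x - a) := by
    change (MvPolynomial.eval (fun i => x i) q • α).curryLeft x
      - MvPolynomial.eval (fun i => x i) q • α.curryLeft a = _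
    rw [map_sub, smul_sub]
    rfl
  refine ⟨φ, ?_, ?_, ?_⟩
  · refine Submodule.sub_mem _ ?_ ?_
    · exact Submodule.mem_sup_right (Submodule.mem_map_of_mem (polySMul_mem hq α))
    · exact Submodule.mem_sup_left (polySMul_mem hq _)
  · refine (cellTrace_eq_zero_iff b (by omega) hs φ).2 fun j x _ hj w hw => ?_
    rw [hval]
    by_cases hjk : k < j.1
    · rw [hq', Finset.prod_eq_zero (Finset.mem_filter.2 ⟨Finset.mem_univ j, hjk⟩) hj, zero_smul]
      rfl
    · -- for `j ≤ k`, the column of `dλ_j` in the determinant vanishes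
      have : α.curryLeft (x - a) w = 0 := by
        rw [ContinuousAlternatingMap.curryLeft_apply_apply, hα, wedgeBary_apply]
        refine Matrix.det_eq_zero_of_column_eq_zero (⟨j.1, by omega⟩ : Fin (k + 1)) fun l => ?_
        have e : Fin.castLE (by omega : k + 1 ≤ n + 1) ⟨j.1, by omega⟩ = j := Fin.ext rfl
        simp only [Matrix.of_apply, e]
        refine Fin.cases ?_ (fun l => ?_) l
        · have hne : j ≠ Fin.last n := fun h => by simp [h] at hjk; omega
          simp [dbary_sub, hj, ha, b.coord_apply_ne hne]
        · exact hw l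
      rw [ContinuousAlternatingMap.smul_apply, this, smul_zero]
  · intro h0
    -- the barycenter of the face spanned by `a_{k+1}, …, a_n`
    set S : Finset (Fin (n + 1)) := Finset.univ.filter fun j => k < j.1 with hS
    have hSn : (Fin.last n) ∈ S := by simp [hS, hk]
    set c := Finset.affineCombination ℝ S b (fun _ => (S.card : ℝ)⁻¹) with hc
    have hcard : (S.card : ℝ) ≠ 0 := by
      exact_mod_cast (Finset.card_pos.2 ⟨_, hSn⟩).ne'
    have hw1 : ∑ _i ∈ S, (S.card : ℝ)⁻¹ = 1 := by simp [hcard]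
    have hin (j) (hj : j ∈ S) : b.coord j c = (S.card : ℝ)⁻¹ :=
      b.coord_apply_combination_of_mem hj hw1
    have hout (j) (hj : j ∉ S) : b.coord j c = 0 :=
      b.coord_apply_combination_of_notMem hj hw1
    have hqc : MvPolynomial.eval (fun i => c i) q ≠ 0 := by
      rw [hq']
      refine Finset.prod_ne_zero_iff.2 fun j hj => ?_
      rw [hin j hj]
      exact inv_ne_zero hcard
    have hcα : α.curryLeft (c - a) = 0 := by
      ext w
      rw [ContinuousAlternatingMap.curryLeft_apply_apply, hα, wedgeBary_apply]
      refine Matrix.det_eq_zero_of_row_eq_zero 0 fun i => ?_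
      have hi : Fin.castLE (by omega : k + 1 ≤ n + 1) i ∉ S := by
        have := i.2; simp [hS]; omega
      have hne : Fin.castLE (by omega : k + 1 ≤ n + 1) i ≠ Fin.last n := fun h => hi (h ▸ hSn)
      simp [dbary_sub, hout _ hi, ha, b.coord_apply_ne hne]
    have hd : HasFDerivAt φ.val (MvPolynomial.eval (fun i => c i) q • α.curryLeft) c := by
      have h1 : HasFDerivAt (fun x : Euc n => MvPolynomial.eval (fun i => x i) q)
          (fderiv ℝ (fun x : Euc n => MvPolynomial.eval (fun i => x i) q) c) c :=
        ((contDiff_eval q).differentiable (by simp) c).hasFDerivAt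
      have h2 : HasFDerivAt (fun x => α.curryLeft (x - a)) α.curryLeft c := by
        have := (α.curryLeft).hasFDerivAt.comp c ((hasFDerivAt_id c).sub_const a)
        rw [ContinuousLinearMap.comp_id] at this
        exact this
      have h3 := h1.smul h2
      simp only [hcα, ContinuousLinearMap.smulRight_zero, add_zero] at h3
      have e : φ.val = fun x => MvPolynomial.eval (fun i => x i) q • α.curryLeft (x - a) :=
        funext hval
      rw [e]
      exact h3
    have h1 : (extD n k φ).val c = 0 := by rw [h0]; rfl
    change ContinuousAlternatingMap.alternatizeUncurryFin (fderiv ℝ φ.val c) = 0 at h1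
    rw [hd.fderiv, ContinuousAlternatingMap.alternatizeUncurryFin_smul,
      ContinuousAlternatingMap.alternatizeUncurryFin_curryLeft] at h1
    have h2 : α (fun l => b (Fin.castLE (by omega) l) - a) = 1 := by
      rw [hα, wedgeBary_apply]
      convert Matrix.det_one (R := ℝ) (n := Fin (k + 1))
      ext l i
      have hne : Fin.castLE (by omega : k + 1 ≤ n + 1) i ≠ Fin.last n := by
        intro h
        have := congrArg Fin.val h
        simp at this
        omega
      rw [Matrix.of_apply, ha, dbary_vertex_sub, Matrix.one_apply, if_neg hne]
      simp [Fin.ext_iff, eq_comm]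
    have h3 := congrArg (fun β => β (fun l => b (Fin.castLE (by omega) l) - a)) h1
    simp [h2] at h3
    rcases h3 with h3 | h3
    · exact hqc h3
    · exact absurd h3 (by positivity)

end Bubble

/-! ### Integration by parts on a simplex -/

section Divergence

open Filter Topology

/-- A smooth step: `0` on `(-∞, 1]`, `1` on `[2, ∞)`, and between `0` and `1` elsewhere. -/
def stepFun (t : ℝ) : ℝ := Real.smoothTransition (t - 1)

theorem contDiff_stepFun : ContDiff ℝ 1 stepFun :=
  (Real.smoothTransition.contDiff (n := 1)).comp (contDiff_id.sub contDiff_const)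

theorem stepFun_of_le {t : ℝ} (h : t ≤ 1) : stepFun t = 0 :=
  Real.smoothTransition.zero_of_nonpos (by linarith)

theorem stepFun_of_ge {t : ℝ} (h : 2 ≤ t) : stepFun t = 1 :=
  Real.smoothTransition.one_of_one_le (by linarith)

theorem abs_stepFun_le (t : ℝ) : |stepFun t| ≤ 1 := by
  rw [stepFun, abs_of_nonneg (Real.smoothTransition.nonneg _)]
  exact Real.smoothTransition.le_one _

theorem deriv_stepFun_of_lt {t : ℝ} (h : t < 1) : deriv stepFun t = 0 := by
  have : stepFun =ᶠ[𝓝 t] fun _ => 0 := by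
    filter_upwards [Iio_mem_nhds h] with u hu using stepFun_of_le (le_of_lt hu)
  rw [this.deriv_eq, deriv_const]

theorem deriv_stepFun_of_gt {t : ℝ} (h : 2 < t) : deriv stepFun t = 0 := by
  have : stepFun =ᶠ[𝓝 t] fun _ => 1 := by
    filter_upwards [Ioi_mem_nhds h] with u hu using stepFun_of_ge (le_of_lt hu)
  rw [this.deriv_eq, deriv_const]

theorem exists_abs_mul_deriv_stepFun_le : ∃ C, ∀ t, |t * deriv stepFun t| ≤ C := by
  have hc : Continuous fun t => t * deriv stepFun t :=
    continuous_id.mul (contDiff_stepFun.continuous_deriv le_rfl)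
  refine hc.bounded_above_of_compact_support ?_
  refine HasCompactSupport.intro (isCompact_Icc (a := (1 : ℝ)) (b := 2)) fun t ht => ?_
  rcases not_and_or.1 ht with h | h
  · rw [deriv_stepFun_of_lt (not_le.1 h), mul_zero]
  · rw [deriv_stepFun_of_gt (not_le.1 h), mul_zero]

variable {n : ℕ} (b : AffineBasis (Fin (n + 1)) ℝ (Euc n))

theorem hasFDerivAt_coord (j : Fin (n + 1)) (x : Euc n) :
    HasFDerivAt (b.coord j) (dbary b j) x := by
  have e : (b.coord j : Euc n → ℝ) = fun y => b.coord j 0 + dbary b j y := by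
    funext y
    simpa using coord_add b j 0 y
  rw [e]
  exact (dbary b j).hasFDerivAt.const_add _

theorem contDiff_coord (j : Fin (n + 1)) : ContDiff ℝ 1 (b.coord j) := by
  have e : (b.coord j : Euc n → ℝ) = fun y => b.coord j 0 + dbary b j y := by
    funext y
    simpa using coord_add b j 0 y
  rw [e]
  exact contDiff_const.add (dbary b j).contDiff

theorem mem_simplex_iff (x : Euc n) :
    x ∈ convexHull ℝ (Set.range b) ↔ ∀ i, 0 ≤ b.coord i x := by
  rw [b.convexHull_eq_nonneg_coord]
  rfl

theorem isCompact_simplex : IsCompact (convexHull ℝ (Set.range b)) :=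
  (Set.finite_range b).isCompact_convexHull ℝ

/-- A cutoff function supported where all barycentric coordinates are at least `ε`. -/
def cutoff (ε : ℝ) (x : Euc n) : ℝ := ∏ j, stepFun (b.coord j x / ε)

theorem contDiff_cutoff (ε : ℝ) : ContDiff ℝ 1 (cutoff b ε) :=
  contDiff_prod fun j _ => contDiff_stepFun.comp ((contDiff_coord b j).div_const ε)

theorem cutoff_eq_zero {ε : ℝ} (hε : 0 < ε) {x : Euc n} (hx : x ∉ convexHull ℝ (Set.range b)) :
    cutoff b ε x = 0 := by
  rw [mem_simplex_iff] at hx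
  push Not at hx
  obtain ⟨j, hj⟩ := hx
  refine Finset.prod_eq_zero (Finset.mem_univ j) (stepFun_of_le ?_)
  exact (div_neg_of_neg_of_pos hj hε).le.trans zero_le_one

theorem abs_cutoff_le (ε : ℝ) (x : Euc n) : |cutoff b ε x| ≤ 1 := by
  rw [cutoff, Finset.abs_prod]
  exact Finset.prod_le_one (fun _ _ => abs_nonneg _) fun _ _ => abs_stepFun_le _

theorem hasCompactSupport_cutoff {ε : ℝ} (hε : 0 < ε) : HasCompactSupport (cutoff b ε) :=
  HasCompactSupport.intro (isCompact_simplex b) fun _ hx => cutoff_eq_zero b hε hx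

theorem fderiv_cutoff (ε : ℝ) (x w : Euc n) :
    fderiv ℝ (cutoff b ε) x w = ∑ j, (∏ i ∈ Finset.univ.erase j, stepFun (b.coord i x / ε)) *
      (deriv stepFun (b.coord j x / ε) * (dbary b j w / ε)) := by
  have h (j : Fin (n + 1)) : HasFDerivAt (fun x => stepFun (b.coord j x / ε))
      (deriv stepFun (b.coord j x / ε) • (ε⁻¹ • dbary b j)) x := by
    have h1 : HasDerivAt stepFun (deriv stepFun (b.coord j x / ε)) (b.coord j x / ε) :=
      ((contDiff_stepFun.differentiable (by simp)) _).hasDerivAt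
    refine HasDerivAt.comp_hasFDerivAt (h₂ := stepFun) x h1 ?_
    simp_rw [div_eq_inv_mul]
    exact (hasFDerivAt_coord b j x).const_mul _
  have := HasFDerivAt.finsetProd (u := Finset.univ) (fun j _ => h j)
  unfold cutoff
  rw [this.fderiv]
  simp [div_eq_inv_mul]

theorem fderiv_cutoff_eq_zero {ε : ℝ} (hε : 0 < ε) {x : Euc n}
    (hx : x ∉ convexHull ℝ (Set.range b)) : fderiv ℝ (cutoff b ε) x = 0 := by
  have : cutoff b ε =ᶠ[𝓝 x] fun _ => 0 := by
    filter_upwards [(isCompact_simplex b).isClosed.isOpen_compl.mem_nhds hx] with y hy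
    exact cutoff_eq_zero b hε hy
  rw [this.fderiv_eq]
  simp

/-- A `C¹` function on a simplex which vanishes on the facet `λ_j = 0` is bounded by a multiple of
`λ_j`. -/
theorem exists_abs_le_mul_coord (hn : 1 ≤ n) (j : Fin (n + 1)) {g : Euc n → ℝ}
    (hg : ContDiff ℝ 1 g) (h : ∀ x, (∀ i, 0 ≤ b.coord i x) → b.coord j x = 0 → g x = 0) :
    ∃ C, 0 ≤ C ∧ ∀ x ∈ convexHull ℝ (Set.range b), |g x| ≤ C * b.coord j x := by
  obtain ⟨C, hC⟩ := (isCompact_simplex b).exists_bound_of_continuousOn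
    (hg.continuous_fderiv one_ne_zero).continuousOn
  have : Nontrivial (Fin (n + 1)) := Fin.nontrivial_iff_two_le.2 (by omega)
  obtain ⟨m, hm⟩ := exists_ne j
  have hC0 : 0 ≤ C := (norm_nonneg _).trans (hC (b j) (subset_convexHull ℝ _ ⟨j, rfl⟩))
  refine ⟨C * ‖b m - b j‖, by positivity, fun x hx => ?_⟩
  have hx' := (mem_simplex_iff b x).1 hx
  -- move the weight of the vertex `j` to the vertex `m`
  set x' := x + b.coord j x • (b m - b j) with hx'def
  have hco (i) : b.coord i x' = b.coord i x
      + b.coord j x * ((if i = m then 1 else 0) - (if i = j then 1 else 0)) := by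
    rw [hx'def, coord_add, map_smul, dbary_vertex_sub, smul_eq_mul]
  have hj0 : b.coord j x' = 0 := by rw [hco]; simp [hm.symm]
  have hnn (i) : 0 ≤ b.coord i x' := by
    by_cases hij : i = j
    · rw [hij, hj0]
    · rw [hco, if_neg hij]
      split_ifs
      · have := hx' i; have := hx' j; linarith
      · have := hx' i; linarith
  have hle := (convex_convexHull ℝ (Set.range b)).norm_image_sub_le_of_norm_fderiv_le
    (fun y _ => (hg.differentiable (by simp)) y) hC ((mem_simplex_iff b x').2 hnn) hx
  rw [h x' hnn hj0, sub_zero, Real.norm_eq_abs] at hle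
  refine hle.trans_eq ?_
  have : x - x' = -(b.coord j x • (b m - b j)) := by rw [hx'def]; abel
  rw [this, norm_neg, norm_smul, Real.norm_eq_abs, abs_of_nonneg (hx' j)]
  ring

/-- The divergence theorem for a vector field on a simplex with vanishing normal component on the
boundary. -/
theorem integral_div_eq_zero (hn : 1 ≤ n) {X : Fin n → Euc n → ℝ}
    (hX : ∀ i, ContDiff ℝ 1 (X i))
    (h : ∀ j x, (∀ i, 0 ≤ b.coord i x) → b.coord j x = 0 →
      ∑ i, dbary b j (stdVec n i) * X i x = 0) :
    ∫ x in convexHull ℝ (Set.range b), ∑ i, fderiv ℝ (X i) x (stdVec n i) = 0 := by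
  set K := convexHull ℝ (Set.range b) with hK
  have hKc : IsCompact K := isCompact_simplex b
  have hXd (i) : Continuous fun x => fderiv ℝ (X i) x (stdVec n i) :=
    ((hX i).continuous_fderiv one_ne_zero).clm_apply continuous_const
  have hdiv : Continuous fun x => ∑ i, fderiv ℝ (X i) x (stdVec n i) :=
    continuous_finsetSum _ fun i _ => hXd i
  have hcd (ε : ℝ) (i) : Continuous fun x => fderiv ℝ (cutoff b ε) x (stdVec n i) :=
    ((contDiff_cutoff b ε).continuous_fderiv one_ne_zero).clm_apply continuous_const
  -- integration by parts against the cutoff function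
  have hparts (ε : ℝ) (hε : 0 < ε) :
      ∫ x in K, cutoff b ε x * ∑ i, fderiv ℝ (X i) x (stdVec n i)
        = - ∫ x in K, ∑ i, fderiv ℝ (cutoff b ε) x (stdVec n i) * X i x := by
    have hs := hasCompactSupport_cutoff b hε
    have hs' (i) : HasCompactSupport fun x => fderiv ℝ (cutoff b ε) x (stdVec n i) :=
      hs.fderiv_apply (𝕜 := ℝ) _
    have i1 (i) : Integrable fun x => fderiv ℝ (cutoff b ε) x (stdVec n i) * X i x :=
      ((hcd ε i).mul (hX i).continuous).integrable_of_hasCompactSupport (hs' i).mul_right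
    have i2 (i) : Integrable fun x => cutoff b ε x * fderiv ℝ (X i) x (stdVec n i) :=
      ((contDiff_cutoff b ε).continuous.mul (hXd i)).integrable_of_hasCompactSupport hs.mul_right
    have i3 (i) : Integrable fun x => cutoff b ε x * X i x :=
      ((contDiff_cutoff b ε).continuous.mul (hX i).continuous).integrable_of_hasCompactSupport
        hs.mul_right
    rw [setIntegral_eq_integral_of_forall_compl_eq_zero,
      setIntegral_eq_integral_of_forall_compl_eq_zero]
    · simp_rw [Finset.mul_sum]
      rw [integral_finsetSum _ fun i _ => i2 i, integral_finsetSum _ fun i _ => i1 i,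
        ← Finset.sum_neg_distrib]
      refine Finset.sum_congr rfl fun i _ => ?_
      exact integral_mul_fderiv_eq_neg_fderiv_mul_of_integrable (i1 i) (i2 i) (i3 i)
        (fun x _ => (contDiff_cutoff b ε).differentiable (by simp) x)
        (fun x _ => (hX i).differentiable (by simp) x)
    · intro x hx
      simp [fderiv_cutoff_eq_zero b hε hx]
    · intro x hx
      simp [cutoff_eq_zero b hε hx]
  -- the normal components are `O(λ_j)` near the facets
  have hnormal (j : Fin (n + 1)) : ∃ C, 0 ≤ C ∧ ∀ x ∈ K,
      |∑ i, dbary b j (stdVec n i) * X i x| ≤ C * b.coord j x :=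
    exists_abs_le_mul_coord b hn j (ContDiff.sum fun i _ => contDiff_const.mul (hX i)) (h j)
  choose C hC0 hC using hnormal
  obtain ⟨D, hD⟩ := exists_abs_mul_deriv_stepFun_le
  have hgrad (ε : ℝ) (x) : ∑ i, fderiv ℝ (cutoff b ε) x (stdVec n i) * X i x
      = ∑ j, (∏ i ∈ Finset.univ.erase j, stepFun (b.coord i x / ε)) *
        (deriv stepFun (b.coord j x / ε) * ((∑ i, dbary b j (stdVec n i) * X i x) / ε)) := by
    simp_rw [fderiv_cutoff, Finset.sum_mul]
    rw [Finset.sum_comm]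
    refine Finset.sum_congr rfl fun j _ => ?_
    rw [Finset.sum_div, Finset.mul_sum, Finset.mul_sum]
    refine Finset.sum_congr rfl fun i _ => by ring
  have hbound (ε : ℝ) (hε : 0 < ε) (x) (hx : x ∈ K) :
      |∑ i, fderiv ℝ (cutoff b ε) x (stdVec n i) * X i x| ≤ ∑ j, D * C j := by
    rw [hgrad]
    refine (Finset.abs_sum_le_sum_abs _ _).trans (Finset.sum_le_sum fun j _ => ?_)
    rw [abs_mul, Finset.abs_prod]
    have h1 : ∏ i ∈ Finset.univ.erase j, |stepFun (b.coord i x / ε)| ≤ 1 :=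
      Finset.prod_le_one (fun _ _ => abs_nonneg _) fun _ _ => abs_stepFun_le _
    have h2 : |deriv stepFun (b.coord j x / ε) * ((∑ i, dbary b j (stdVec n i) * X i x) / ε)|
        ≤ D * C j := by
      have hx0 := (mem_simplex_iff b x).1 hx j
      calc |deriv stepFun (b.coord j x / ε) * ((∑ i, dbary b j (stdVec n i) * X i x) / ε)|
          = |deriv stepFun (b.coord j x / ε)| * (|∑ i, dbary b j (stdVec n i) * X i x| / ε) := by
            rw [abs_mul, abs_div, abs_of_pos hε]
        _ ≤ |deriv stepFun (b.coord j x / ε)| * ((C j * b.coord j x) / ε) := by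
            gcongr
            exact hC j x hx
        _ = |b.coord j x / ε * deriv stepFun (b.coord j x / ε)| * C j := by
            rw [abs_mul, abs_of_nonneg (div_nonneg hx0 hε.le)]
            ring
        _ ≤ D * C j := mul_le_mul_of_nonneg_right (hD _) (hC0 j)
    calc _ ≤ 1 * (D * C j) := mul_le_mul h1 h2 (abs_nonneg _) zero_le_one
      _ = D * C j := one_mul _
  have hε (m : ℕ) : (0 : ℝ) < 1 / ((m : ℝ) + 1) := Nat.one_div_pos_of_nat
  -- for positive `t`, eventually `t / ε > 2`
  have hev {t : ℝ} (ht : 0 < t) : ∀ᶠ m : ℕ in atTop, 2 < t / (1 / ((m : ℝ) + 1)) := by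
    obtain ⟨N, hN⟩ := exists_nat_gt (2 / t)
    filter_upwards [eventually_ge_atTop N] with m hm
    have : (N : ℝ) ≤ m := by exact_mod_cast hm
    rw [div_div_eq_mul_div, div_one]
    have h2 : 2 < N * t := (div_lt_iff₀ ht).1 hN
    nlinarith
  have hlim1 : Tendsto (fun m : ℕ => ∫ x in K, cutoff b (1 / ((m : ℝ) + 1)) x *
      ∑ i, fderiv ℝ (X i) x (stdVec n i)) atTop
      (𝓝 (∫ x in K, ∑ i, fderiv ℝ (X i) x (stdVec n i))) := by
    refine tendsto_integral_of_dominated_convergence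
      (fun x => |∑ i, fderiv ℝ (X i) x (stdVec n i)|) (fun m => ?_) ?_ (fun m => ?_) ?_
    · exact ((contDiff_cutoff b _).continuous.mul hdiv).aestronglyMeasurable
    · exact (hdiv.abs.continuousOn).integrableOn_compact hKc
    · refine Eventually.of_forall fun x => ?_
      rw [Real.norm_eq_abs, abs_mul]
      exact mul_le_of_le_one_left (abs_nonneg _) (abs_cutoff_le b _ x)
    · have hfr := measure_eq_zero_iff_ae_notMem.1
        ((convex_convexHull ℝ (Set.range b)).addHaar_frontier (volume : Measure (Euc n)))
      filter_upwards [ae_restrict_mem hKc.measurableSet, ae_restrict_of_ae hfr] with x hx hx'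
      have hint : x ∈ interior K := by
        by_contra hni
        exact hx' ⟨subset_closure hx, hni⟩
      rw [hK, b.interior_convexHull] at hint
      refine tendsto_const_nhds.congr' ?_
      filter_upwards [eventually_all.2 fun i => hev (hint i)] with m hm
      rw [cutoff, Finset.prod_eq_one fun i _ => stepFun_of_ge (hm i).le, one_mul]
  have hlim2 : Tendsto (fun m : ℕ => ∫ x in K, ∑ i,
      fderiv ℝ (cutoff b (1 / ((m : ℝ) + 1))) x (stdVec n i) * X i x) atTop
      (𝓝 (∫ _ in K, 0)) := by
    refine tendsto_integral_of_dominated_convergence (fun _ => ∑ j, D * C j) (fun m => ?_) ?_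
      (fun m => ?_) ?_
    · exact (continuous_finsetSum _ fun i _ =>
        (hcd _ i).mul (hX i).continuous).aestronglyMeasurable
    · exact continuousOn_const.integrableOn_compact hKc
    · filter_upwards [ae_restrict_mem hKc.measurableSet] with x hx
      exact hbound _ (hε m) x hx
    · filter_upwards [ae_restrict_mem hKc.measurableSet] with x hx
      have hx0 := (mem_simplex_iff b x).1 hx
      refine tendsto_const_nhds.congr' ?_
      have hder (j : Fin (n + 1)) : ∀ᶠ m : ℕ in atTop,
          deriv stepFun (b.coord j x / (1 / ((m : ℝ) + 1))) = 0 := by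
        rcases (hx0 j).eq_or_lt with h0 | h0
        · refine Eventually.of_forall fun m => deriv_stepFun_of_lt ?_
          rw [← h0, zero_div]
          exact zero_lt_one
        · filter_upwards [hev h0] with m hm using deriv_stepFun_of_gt hm
      filter_upwards [eventually_all.2 hder] with m hm
      rw [hgrad]
      refine (Finset.sum_eq_zero fun j _ => ?_).symm
      rw [hm j, zero_mul, mul_zero]
  rw [integral_zero] at hlim2
  have hlim3 := hlim2.neg
  rw [neg_zero] at hlim3
  refine tendsto_nhds_unique hlim1 (hlim3.congr fun m => ?_)
  exact (hparts _ (hε m)).symm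

theorem hasFDerivAt_coeff {k : ℕ} (φ : SForm n k) (e : Fin k → Euc n) (x : Euc n) :
    HasFDerivAt (fun y => φ.val y e)
      ((ContinuousAlternatingMap.apply ℝ (Euc n) ℝ e).comp (fderiv ℝ φ.val x)) x :=
  (ContinuousAlternatingMap.apply ℝ (Euc n) ℝ e).hasFDerivAt.comp x
    ((φ.contDiff.differentiable (by simp)) x).hasFDerivAt

theorem contDiff_coeff {k : ℕ} (φ : SForm n k) (e : Fin k → Euc n) :
    ContDiff ℝ 1 (fun y => φ.val y e) :=
  ((ContinuousAlternatingMap.apply ℝ (Euc n) ℝ e).contDiff.comp φ.contDiff).of_le (by simp)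

theorem altInner_codiff {k : ℕ} (α : Alt n k) (η : Euc n → Alt n (k + 1)) (x : Euc n) :
    altInner α (codiff η x)
      = -∑ i, altInner α ((fderiv ℝ η x (stdVec n i)).curryLeft (stdVec n i)) := by
  simp only [altInner, codiff, ContinuousAlternatingMap.neg_apply,
    ContinuousAlternatingMap.sum_apply, mul_neg, Finset.mul_sum, Finset.sum_neg_distrib]
  rw [Finset.sum_comm]

/-- Integration by parts on a simplex for a form with vanishing tangential trace: there is no
boundary term. -/
theorem integral_altInner_extD (hn : 1 ≤ n) {k : ℕ} {v : SForm n k} {s : Finset (Euc n)}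
    (hs : Set.range b = s) (hv : cellTrace s v = 0) (η : SForm n (k + 1)) :
    ∫ x in convexHull ℝ (s : Set (Euc n)), altInner ((extD n k v).val x) (η.val x)
      = ∫ x in convexHull ℝ (s : Set (Euc n)), altInner (v.val x) (codiff η.val x) := by
  -- the vector field dual to `v ∧ ⋆η`
  set X : Fin n → Euc n → ℝ := fun i x =>
    altInner (v.val x) ((η.val x).curryLeft (stdVec n i)) with hX
  have hXc (i) : ContDiff ℝ 1 (X i) :=
    ContDiff.sum fun I _ => (contDiff_coeff v _).mul (contDiff_coeff η _)
  have hXd (i) (x w : Euc n) : fderiv ℝ (X i) x w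
      = altInner (fderiv ℝ v.val x w) ((η.val x).curryLeft (stdVec n i))
        + altInner (v.val x) ((fderiv ℝ η.val x w).curryLeft (stdVec n i)) := by
    have h : HasFDerivAt (X i) _ x := HasFDerivAt.fun_sum fun I _ =>
      (hasFDerivAt_coeff v (fun j => stdVec n (I j)) x).mul
        (hasFDerivAt_coeff η (Matrix.vecCons (stdVec n i) fun j => stdVec n (I j)) x)
    rw [h.fderiv]
    simp only [altInner, ← Finset.sum_add_distrib, _root_.sum_apply]
    refine Finset.sum_congr rfl fun I _ => ?_
    simp only [_root_.add_apply, _root_.smul_apply, smul_eq_mul,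
      ContinuousLinearMap.comp_apply, ContinuousAlternatingMap.apply_apply,
      ContinuousAlternatingMap.curryLeft_apply_apply]
    ring
  have hdiv (x : Euc n) : ∑ i, fderiv ℝ (X i) x (stdVec n i)
      = altInner ((extD n k v).val x) (η.val x) - altInner (v.val x) (codiff η.val x) := by
    have h1 : altInner ((extD n k v).val x) (η.val x) = _ :=
      altInner_alternatizeUncurryFin (fderiv ℝ v.val x) (η.val x)
    rw [h1, altInner_codiff, sub_neg_eq_add, ← Finset.sum_add_distrib]
    exact Finset.sum_congr rfl fun i _ => hXd i x _
  have hv' := (cellTrace_eq_zero_iff b hn hs v).1 hv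
  have h0 := integral_div_eq_zero b hn hXc fun j x hx hj => by
    -- of the edges at a vertex `m ≠ j`, only the one to the vertex `j` is transversal to the facet
    have : Nontrivial (Fin (n + 1)) := Fin.nontrivial_iff_two_le.2 (by omega)
    obtain ⟨m, hm⟩ := exists_ne j
    refine sum_mul_altInner_curryLeft_eq_zero (b.basisOf m) ⟨j, hm.symm⟩ (dbary b j) ?_ (v.val x)
      (hv' j x hx hj) (η.val x)
    rintro ⟨i, hi⟩ hij
    have hji : j ≠ i := fun h => hij (Subtype.ext h.symm)
    rw [AffineBasis.basisOf_apply, vsub_eq_sub, dbary_vertex_sub, if_neg hji, if_neg hm.symm,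
      sub_zero]
  rw [hs] at h0
  simp_rw [hdiv] at h0
  rw [integral_sub (integrableOn_altInner s (extD n k v) η)] at h0
  · linarith
  · refine ContinuousOn.integrableOn_compact (s.finite_toSet.isCompact_convexHull ℝ) ?_
    refine Continuous.continuousOn (continuous_finsetSum _ fun I _ => ?_)
    exact (continuous_coeff v _).mul
      ((ContinuousAlternatingMap.apply ℝ (Euc n) ℝ _).continuous.comp (continuous_codiff η))

end Divergence

/-! ### Broken forms with zero trace -/

namespace SimplicialMesh

variable {n : ℕ} (M : SimplicialMesh n)

theorem exists_affineBasis (K : M.cells) :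
    ∃ b : AffineBasis (Fin (n + 1)) ℝ (Euc n), Set.range b = (K.1 : Set (Euc n)) := by
  have hi : AffineIndependent ℝ ((↑) : K.1 → Euc n) := M.indep K.2.1
  have ht : affineSpan ℝ (Set.range ((↑) : K.1 → Euc n)) = ⊤ := by
    refine hi.affineSpan_eq_top_iff_card_eq_finrank_add_one.2 ?_
    simpa using K.2.2
  let b : AffineBasis K.1 ℝ (Euc n) := ⟨_, hi, ht⟩
  refine ⟨b.reindex (K.1.equivFinOfCardEq K.2.2), ?_⟩
  rw [AffineBasis.coe_reindex, EquivLike.range_comp]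
  exact Subtype.range_coe

theorem nonempty_cells : Nonempty M.cells := by
  obtain ⟨s, hs⟩ := M.nonempty_faces
  obtain ⟨t, ht, -, hc⟩ := M.pure s hs
  exact ⟨⟨t, ht, hc⟩⟩

theorem glue_apply {k : ℕ} (v : M.Broken k) (x : Euc n) (e : Fin k → Euc n) :
    M.glue k v x e
      = ∑ K : M.cells, (convexHull ℝ (K.1 : Set (Euc n))).indicator (fun y => (v K).val y e) x := by
  change (∑ K : M.cells,
    (convexHull ℝ (K.1 : Set (Euc n))).indicator (fun y => (v K).val y) x : Alt n k) e = _
  rw [ContinuousAlternatingMap.sum_apply]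
  refine Finset.sum_congr rfl fun K _ => ?_
  by_cases h : x ∈ convexHull ℝ (K.1 : Set (Euc n)) <;> simp [h]

theorem isCompact_cell (K : M.cells) : IsCompact (convexHull ℝ (K.1 : Set (Euc n))) :=
  K.1.finite_toSet.isCompact_convexHull ℝ

theorem memL2_glue {k : ℕ} (v : M.Broken k) : MemL2 M.domain (M.glue k v) := by
  intro I
  simp_rw [glue_apply]
  refine MemLp.restrict _ (memLp_finsetSum _ fun K _ => ?_)
  have hK := M.isCompact_cell K
  rw [memLp_indicator_iff_restrict hK.measurableSet]
  have hc := continuous_coeff (v K) (fun j => stdVec n (I j))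
  have : IsFiniteMeasure (volume.restrict (convexHull ℝ (K.1 : Set (Euc n)))) :=
    isFiniteMeasure_restrict.2 hK.measure_lt_top.ne
  obtain ⟨C, hC⟩ := hK.exists_bound_of_continuousOn hc.continuousOn
  refine MemLp.of_bound hc.aestronglyMeasurable C ?_
  filter_upwards [ae_restrict_mem hK.measurableSet] with x hx using hC x hx

theorem setIntegral_altInner_glue {k : ℕ} (v : M.Broken k) {g : Euc n → Alt n k}
    (hg : Continuous g) (h0 : ∀ x, x ∉ M.domain → g x = 0) :
    ∫ x in M.domain, altInner (M.glue k v x) (g x)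
      = ∑ K : M.cells, ∫ x in convexHull ℝ (K.1 : Set (Euc n)), altInner ((v K).val x) (g x) := by
  rw [setIntegral_eq_integral_of_forall_compl_eq_zero fun x hx => by simp [h0 x hx, altInner]]
  have e (x : Euc n) : altInner (M.glue k v x) (g x)
      = ∑ K : M.cells, (convexHull ℝ (K.1 : Set (Euc n))).indicator
          (fun y => altInner ((v K).val y) (g y)) x := by
    simp only [altInner, glue_apply, Finset.sum_mul]
    rw [Finset.sum_comm]
    refine Finset.sum_congr rfl fun K _ => ?_
    by_cases h : x ∈ convexHull ℝ (K.1 : Set (Euc n)) <;> simp [h]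
  simp_rw [e]
  rw [integral_finsetSum]
  · exact Finset.sum_congr rfl fun K _ => integral_indicator (M.isCompact_cell K).measurableSet
  · intro K _
    rw [integrable_indicator_iff (M.isCompact_cell K).measurableSet]
    refine ContinuousOn.integrableOn_compact (M.isCompact_cell K) (Continuous.continuousOn ?_)
    exact continuous_finsetSum _ fun I _ => (continuous_coeff _ _).mul
      ((ContinuousAlternatingMap.apply ℝ (Euc n) ℝ _).continuous.comp hg)

/-- The broken forms `∏_K W̊_h(K)` with zero tangential trace on the boundary of every element. -/
def zeroTraceSpace {k : ℕ} (P : Submodule ℝ (SForm n k)) : Submodule ℝ (M.Broken k) :=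
  M.brokenSpace P ⊓ LinearMap.ker (M.trace k)

variable {M}

theorem mem_zeroTraceSpace {k : ℕ} {P : Submodule ℝ (SForm n k)} {v : M.Broken k} :
    v ∈ M.zeroTraceSpace P ↔ ∀ K : M.cells, v K ∈ cellZeroTrace K.1 P := by
  constructor
  · rintro ⟨h1, h2⟩ K
    exact ⟨h1 K trivial, congrFun h2 K⟩
  · intro h
    exact ⟨fun K _ => (h K).1, funext fun K => (h K).2⟩

variable (M)

/-- A broken form with zero traces belongs to `H Λ(Ω)`, its weak exterior derivative being the
elementwise one, because no boundary terms arise when integrating by parts element by element. -/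
theorem zeroTraceSpace_le_femSpace (hn : 1 ≤ n) {k : ℕ} (P : Submodule ℝ (SForm n k)) :
    M.zeroTraceSpace P ≤ M.femSpace P := by
  intro v hv
  refine ⟨hv.1, M.memL2_glue v, M.glue (k + 1) (M.d k v), M.memL2_glue _, fun η hc hs => ?_⟩
  have hz (x : Euc n) (hx : x ∉ tsupport η.val) : codiff η.val x = 0 := by
    have hf : fderiv ℝ η.val x = 0 := fderiv_of_notMem_tsupport ℝ hx
    have h0 : (0 : Alt n (k + 1)).curryLeft = 0 := by ext; simp
    simp [codiff, hf, h0]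
  rw [M.setIntegral_altInner_glue _ η.contDiff.continuous fun x hx =>
      image_eq_zero_of_notMem_tsupport fun h => hx (hs h),
    M.setIntegral_altInner_glue _ (continuous_codiff η) fun x hx => hz x fun h => hx (hs h)]
  refine Finset.sum_congr rfl fun K _ => ?_
  obtain ⟨b, hb⟩ := M.exists_affineBasis K
  exact integral_altInner_extD b hn hb (mem_zeroTraceSpace.1 hv K).2 η

/-! ### Dimension counts -/

variable {k : ℕ} (P : Submodule ℝ (SForm n k))

instance finite_brokenSpace [Module.Finite ℝ P] : Module.Finite ℝ (M.brokenSpace P) := by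
  let L : M.brokenSpace P →ₗ[ℝ] (M.cells → P) :=
    LinearMap.pi fun K => LinearMap.codRestrict P (LinearMap.proj K ∘ₗ (M.brokenSpace P).subtype)
      fun v => v.2 K trivial
  refine Module.Finite.of_injective L fun v w h => Subtype.ext (funext fun K => ?_)
  exact congrArg Subtype.val (congrFun h K)

instance finite_femSpace [Module.Finite ℝ P] : Module.Finite ℝ (M.femSpace P) :=
  Submodule.finiteDimensional_of_le (inf_le_left : _ ≤ M.brokenSpace P)

instance finite_zeroTraceSpace [Module.Finite ℝ P] : Module.Finite ℝ (M.zeroTraceSpace P) :=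
  Submodule.finiteDimensional_of_le (inf_le_left : _ ≤ M.brokenSpace P)

instance finite_femTraces [Module.Finite ℝ P] : Module.Finite ℝ (M.femTraces P) :=
  inferInstanceAs (Module.Finite ℝ ((M.femSpace P).map (M.trace k)))

theorem finrank_femTraces_add_finrank_zeroTraceSpace [Module.Finite ℝ P] (hn : 1 ≤ n) :
    Module.finrank ℝ (M.femTraces P) + Module.finrank ℝ (M.zeroTraceSpace P)
      = Module.finrank ℝ (M.femSpace P) := by
  have h := LinearMap.finrank_range_add_finrank_ker ((M.trace k).domRestrict (M.femSpace P))
  have hle := M.zeroTraceSpace_le_femSpace hn P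
  have e : LinearMap.ker ((M.trace k).domRestrict (M.femSpace P))
      = (M.zeroTraceSpace P).comap (M.femSpace P).subtype := by
    ext v
    exact ⟨fun hv => ⟨v.2.1, hv⟩, fun hv => hv.2⟩
  rw [LinearMap.range_domRestrict, e,
    (Submodule.comapSubtypeEquivOfLe hle).finrank_eq] at h
  exact h

variable (A : Submodule ℝ (SForm n (k - 1))) (B : Submodule ℝ (SForm n k))

instance finite_harmonic [Module.Finite ℝ B] : Module.Finite ℝ (M.harmonic A B) :=
  Submodule.finiteDimensional_of_le (fun _ h => h.1 : M.harmonic A B ≤ M.femSpace B)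

theorem brokenHarmonic_le_zeroTraceSpace : M.brokenHarmonic A B ≤ M.zeroTraceSpace B :=
  fun _ h => mem_zeroTraceSpace.2 fun K => (h K trivial).1.1

instance finite_brokenHarmonic [Module.Finite ℝ B] : Module.Finite ℝ (M.brokenHarmonic A B) :=
  Submodule.finiteDimensional_of_le (M.brokenHarmonic_le_zeroTraceSpace A B)

theorem rank_prod_lt_rank_prod_iff {H H' V W V' W' : Type} [AddCommGroup H] [Module ℝ H]
    [Module.Finite ℝ H] [AddCommGroup H'] [Module ℝ H'] [Module.Finite ℝ H'] [AddCommGroup V]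
    [Module ℝ V] [Module.Finite ℝ V] [AddCommGroup W] [Module ℝ W] [Module.Finite ℝ W]
    [AddCommGroup V'] [Module ℝ V'] [Module.Finite ℝ V'] [AddCommGroup W'] [Module ℝ W']
    [Module.Finite ℝ W'] :
    Module.rank ℝ (H × H' × V' × W') < Module.rank ℝ (V × W × H) ↔
      Module.finrank ℝ H' + Module.finrank ℝ V' + Module.finrank ℝ W'
        < Module.finrank ℝ V + Module.finrank ℝ W := by
  rw [← Module.finrank_eq_rank, ← Module.finrank_eq_rank, Nat.cast_lt]
  simp only [Module.finrank_prod]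
  omega

/-- Condensation eliminates the forms with zero trace, at the cost of the local harmonic forms. -/
theorem size_condensedProblem_lt_iff [Module.Finite ℝ A] [Module.Finite ℝ B] (hn : 1 ≤ n)
    (f : Euc n → Alt n k) :
    (M.condensedProblem A B f).size < (M.feecProblem A B f).size ↔
      Module.finrank ℝ (M.brokenHarmonic A B)
        < Module.finrank ℝ (M.zeroTraceSpace A) + Module.finrank ℝ (M.zeroTraceSpace B) := by
  have hA := M.finrank_femTraces_add_finrank_zeroTraceSpace A hn
  have hB := M.finrank_femTraces_add_finrank_zeroTraceSpace B hn
  have h := rank_prod_lt_rank_prod_iff (H := M.harmonic A B) (H' := M.brokenHarmonic A B)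
    (V' := M.femTraces A) (W' := M.femTraces B) (V := M.femSpace A) (W := M.femSpace B)
  refine Iff.trans h ?_
  omega

theorem single_mem_zeroTraceSpace [DecidableEq M.cells] {K : M.cells} {φ : SForm n k}
    (h : φ ∈ cellZeroTrace K.1 P) : (Pi.single K φ : M.Broken k) ∈ M.zeroTraceSpace P := by
  refine mem_zeroTraceSpace.2 fun K' => ?_
  by_cases hK : K' = K
  · subst hK; simpa using h
  · rw [Pi.single_eq_of_ne hK]; exact zero_mem _

theorem finrank_brokenHarmonic_lt_of_not_closed [Module.Finite ℝ B] {K : M.cells} {φ : SForm n k}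
    (h : φ ∈ cellZeroTrace K.1 B) (hd : extD n k φ ≠ 0) :
    Module.finrank ℝ (M.brokenHarmonic A B) < Module.finrank ℝ (M.zeroTraceSpace B) := by
  classical
  refine Submodule.finrank_lt_finrank_of_lt
    (lt_of_le_of_ne (M.brokenHarmonic_le_zeroTraceSpace A B) fun e => ?_)
  have hm := M.single_mem_zeroTraceSpace B h
  rw [← e] at hm
  have := (hm K trivial).1.2
  rw [Pi.single_eq_same] at this
  exact hd this

theorem finrank_zeroTraceSpace_pos [Module.Finite ℝ P] {K : M.cells} {φ : SForm n k}
    (h : φ ∈ cellZeroTrace K.1 P) (h0 : φ ≠ 0) : 0 < Module.finrank ℝ (M.zeroTraceSpace P) := by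
  classical
  refine Module.finrank_pos_iff_exists_ne_zero.2
    ⟨⟨_, M.single_mem_zeroTraceSpace P h⟩, fun e => h0 ?_⟩
  have := congrFun (congrArg Subtype.val e) K
  simpa using this

variable {P}

theorem zeroTraceSpace_eq_bot {r : ℕ} (hk : k < n) (hr : r + k ≤ n) (hP : P ≤ polyForms n r k) :
    M.zeroTraceSpace P = ⊥ := by
  refine (Submodule.eq_bot_iff _).2 fun v hv => funext fun K => ?_
  obtain ⟨b, hb⟩ := M.exists_affineBasis K
  have h : v K ∈ cellZeroTrace K.1 (polyForms n r k) :=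
    inf_le_inf_right _ hP (mem_zeroTraceSpace.1 hv K)
  rw [cellZeroTrace_polyForms_eq_bot hk hr b hb] at h
  exact h

theorem cellZeroTrace_sigmaElement_eq_bot {r k : ℕ} (s : Family) (hk : k ≤ n) (hr : r + k ≤ n)
    (K : M.cells) : cellZeroTrace K.1 (sigmaElement n r k s) = ⊥ := by
  cases k with
  | zero => exact bot_inf_eq _
  | succ k =>
    obtain ⟨b, hb⟩ := M.exists_affineBasis K
    refine le_bot_iff.1 ?_
    rw [← cellZeroTrace_polyForms_eq_bot (r := r + 1) (k := k) (by omega) (by omega) b hb]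
    exact inf_le_inf_right _ (elementForms_le_polyForms n (r + 1) k s)

/-- Forms of top degree are closed, so they are harmonic as soon as they have nothing to be
orthogonal to. -/
theorem zeroTraceSpace_le_brokenHarmonic_of_eq {A : Submodule ℝ (SForm n (k - 1))}
    (hkn : k = n) (hA : ∀ K : M.cells, cellZeroTrace K.1 A = ⊥) (B : Submodule ℝ (SForm n k)) :
    M.zeroTraceSpace B ≤ M.brokenHarmonic A B := by
  intro v hv K _
  refine ⟨⟨mem_zeroTraceSpace.1 hv K, ?_⟩, ?_⟩
  · refine SForm.ext fun x => ?_
    refine alt_ext_basis (EuclideanSpace.basisFun (Fin n) ℝ).toBasis fun w hw => ?_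
    have := Fintype.card_le_of_injective w hw
    simp at this
    omega
  · refine (Submodule.mem_iInf _).2 fun τ => (Submodule.mem_iInf _).2 fun hτ => ?_
    rw [hA, Submodule.mem_bot] at hτ
    rw [hτ, map_zero, map_zero]
    exact LinearMap.zero_apply _

end SimplicialMesh

end FEEC

end

theorem mainTheorem5 (n k r : ℕ) (hn : 1 ≤ n) (hk : k ≤ n) (M : FEEC.SimplicialMesh n)
    (s t : FEEC.Family) (hr : t = FEEC.Family.full → 1 ≤ r)
    (f : FEEC.Euc n → FEEC.Alt n k) (hf : FEEC.MemL2 M.domain f) :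
    (M.condensedProblem (FEEC.sigmaElement n r k s) (FEEC.uElement n r k t) f).size <
        (M.feecProblem (FEEC.sigmaElement n r k s) (FEEC.uElement n r k t) f).size ↔
      1 ≤ r ∧ ((t = FEEC.Family.full ∧ n - k + 1 ≤ r) ∨
        (t = FEEC.Family.trimmed ∧ n - k ≤ r)) := by
  rw [M.size_condensedProblem_lt_iff _ _ hn f]
  constructor
  · intro h
    by_contra hcon
    -- outside the asserted range, `r + k ≤ n`, so that `W̊_h^{k-1}(K) = 0`
    have hrk : r + k ≤ n := by
      cases t
      · have := hr rfl
        simp [this] at hcon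
        omega
      · simp at hcon
        omega
    have hK := M.cellZeroTrace_sigmaElement_eq_bot s hk hrk
    have hA : M.zeroTraceSpace (FEEC.sigmaElement n r k s) = ⊥ := by
      refine (Submodule.eq_bot_iff _).2 fun v hv => funext fun K => ?_
      have := FEEC.SimplicialMesh.mem_zeroTraceSpace.1 hv K
      rw [hK] at this
      exact this
    have hB : M.zeroTraceSpace (FEEC.uElement n r k t)
        ≤ M.brokenHarmonic (FEEC.sigmaElement n r k s) (FEEC.uElement n r k t) := by
      rcases hk.eq_or_lt with hkn | hkn
      · exact M.zeroTraceSpace_le_brokenHarmonic_of_eq hkn hK _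
      · have : M.zeroTraceSpace (FEEC.uElement n r k t) = ⊥ := by
          cases t
          · exact M.zeroTraceSpace_eq_bot hkn hrk le_rfl
          · -- for the trimmed family even `r + 1 + k ≤ n`
            simp at hcon
            exact M.zeroTraceSpace_eq_bot hkn (r := r + 1) (by omega)
              (FEEC.trimmedForms_le_polyForms n (r + 1) k)
        rw [this]
        exact bot_le
    have h1 := Submodule.finrank_mono hB
    rw [hA, finrank_bot] at h
    omega
  · rintro ⟨hr1, hcase⟩
    obtain ⟨K⟩ := M.nonempty_cells
    obtain ⟨b, hb⟩ := M.exists_affineBasis K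
    rcases hk.eq_or_lt with rfl | hkn
    · -- in top degree all forms are closed, and the form of degree `n - 1` makes the difference
      obtain ⟨j, rfl⟩ : ∃ j, k = j + 1 := ⟨k - 1, by omega⟩
      obtain ⟨φ, hφ, htr, hd⟩ := FEEC.exists_nonclosed_bubble b j.lt_succ_self hb
      have hmem : φ ∈ FEEC.sigmaElement (j + 1) r (j + 1) s :=
        FEEC.trimmedForms_le_elementForms _ _ _ s (FEEC.trimmedForms_mono j (by omega) hφ)
      have h1 := M.finrank_zeroTraceSpace_pos (k := j + 1 - 1)
        (FEEC.sigmaElement (j + 1) r (j + 1) s) (K := K) (φ := φ) ⟨hmem, htr⟩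
        fun h => hd (by rw [h, map_zero])
      have h2 := Submodule.finrank_mono (M.brokenHarmonic_le_zeroTraceSpace
        (FEEC.sigmaElement (j + 1) r (j + 1) s) (FEEC.uElement (j + 1) r (j + 1) t))
      exact lt_of_le_of_lt h2 (Nat.lt_add_of_pos_left h1)
    · obtain ⟨φ, hφ, htr, hd⟩ := FEEC.exists_nonclosed_bubble b hkn hb
      have hmem : φ ∈ FEEC.uElement n r k t := by
        rcases hcase with ⟨rfl, h⟩ | ⟨rfl, h⟩
        · exact FEEC.polyForms_mono k h (FEEC.trimmedForms_le_polyForms _ _ _ hφ)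
        · exact FEEC.trimmedForms_mono k (by omega) hφ
      exact (M.finrank_brokenHarmonic_lt_of_not_closed (FEEC.sigmaElement n r k s) _
        (K := K) ⟨hmem, htr⟩ hd).trans_le (Nat.le_add_left _ _)
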